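/- Let $c,d>0$, $\rho\in(0,1)$ and $\eta>0$. There is a constant $D_1>0$, depending only on $c,d,\rho,\eta$, such that the following holds. For $M\ge 1$ and $1\le r\le M$ let $\mathcal M(\rho,r)$ be the set of real $M\times M$ matrices $Q$ with $\operatorname{rank}(Q)\le r$ and largest singular value $\|Q\|_{S_\infty}\le\rho$. Let $A\in\mathcal M(\rho,r_0)$ for some $r_0\in\{1,\dots,M\}$, and let $(X_t)_{t\ge1}$ be an $\mathbb R^M$-valued stationary process with $X_t=AX_{t-1}+\xi_t$ for $t\ge 2$, where the noise variables $\xi_t$, $t\ge2$, are i.i.d., centered and independent of $X_1$, and $X_1$ follows the stationary distribution of this recursion. Assume that $\mathbb E\exp(|\xi_t^{(j)}|/c)\le d$ for $j=1,\dots,M$. Let $\ell:\mathbb R^M\to\mathbb R$ be $L$-Lipschitz with respect to the Euclidean norm for some $L\le 1$. Let $n$ be an integer with $$n\ \ge\ 1+\frac{16\,\delta_0^2\,M r\log(9rn)}{\mathcal V_0},\qquad \mathcal V_0=\frac{8e\,c^2d(2-\rho)}{(1-\rho)^3},\quad \delta_0=\frac{2c}{1-\rho}.$$ For an $M\times M$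 matrix $Q$ let $R(Q)=\mathbb E[\ell(X_t-QX_{t-1})]$ (well defined and independent of $t\ge2$) and $R_n(Q)=\frac1{n-1}\sum_{i=2}^n\ell(X_i-QX_{i-1})$, and let $\hat A_r\in\mathcal M(\rho,r)$ be a minimizer of $R_n$ over $\mathcal M(\rho,r)$. Then the minimum of $R$ over $\mathcal M(\rho,r)$ is attained and, with probability at least $1-\eta$, $$R(\hat A_r)\ \le\ \min_{Q\in\mathcal M(\rho,r)}R(Q)+D_1\sqrt{rM^2\,\frac{\log n}{n}} .$$ -/

import Mathlib

open MeasureTheory ProbabilityTheory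
open scoped NNReal ENNReal

/-- The largest singular value `‖Q‖_{S_∞}` of a real `M × M` matrix (its Schatten-`∞` norm). -/
noncomputable def schattenInf {M : ℕ} (Q : Matrix (Fin M) (Fin M) ℝ) : ℝ :=
  (Matrix.toEuclideanLin Q).singularValues 0

/-- The Schatten-`∞` norm is the operator norm with respect to the Euclidean norm. -/
theorem schattenInf_eq_opNorm {M : ℕ} (Q : Matrix (Fin M) (Fin M) ℝ) :
    schattenInf Q = ‖Matrix.toEuclideanCLM (n := Fin M) (𝕜 := ℝ) Q‖ := by
  set T := Matrix.toEuclideanLin Q with hT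
  have hTv : ∀ v, Matrix.toEuclideanCLM (n := Fin M) (𝕜 := ℝ) Q v = T v := fun v => rfl
  have hfr : Module.finrank ℝ (EuclideanSpace ℝ (Fin M)) = M := by simp
  apply le_antisymm
  · rcases Nat.eq_zero_or_pos M with h0 | hpos
    · have : schattenInf Q = 0 := T.singularValues_of_finrank_le (by omega)
      rw [this]; positivity
    · obtain ⟨v, hv⟩ := (T.hasEigenvalue_adjoint_comp_self_sq_singularValues
        (n := 0) (by omega)).exists_hasEigenvector
      have h1 : ‖T v‖ ^ 2 = (T.singularValues 0) ^ 2 * ‖v‖ ^ 2 := by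
        rw [← real_inner_self_eq_norm_sq, ← real_inner_self_eq_norm_sq,
          ← LinearMap.adjoint_inner_left]
        have h2 := hv.apply_eq_smul
        simp only [LinearMap.comp_apply] at h2
        rw [h2, inner_smul_left]
        simp
      have hvpos : 0 < ‖v‖ := norm_pos_iff.mpr hv.2
      have h3 := (Matrix.toEuclideanCLM (n := Fin M) (𝕜 := ℝ) Q).le_opNorm v
      rw [hTv] at h3
      have h4 : ‖T v‖ = T.singularValues 0 * ‖v‖ := by
        rw [← mul_pow] at h1
        exact (sq_eq_sq₀ (norm_nonneg _)
          (mul_nonneg (T.singularValues_nonneg 0) (norm_nonneg _))).1 h1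
      rw [h4] at h3
      exact le_of_mul_le_mul_right h3 hvpos
  · refine ContinuousLinearMap.opNorm_le_bound _ (T.singularValues_nonneg 0) fun v => ?_
    rw [hTv]
    have hS := T.isSymmetric_adjoint_comp_self
    let b := hS.eigenvectorBasis hfr
    have h1 : ‖T v‖ ^ 2 ≤ (T.singularValues 0 * ‖v‖) ^ 2 := by
      rw [← real_inner_self_eq_norm_sq, ← LinearMap.adjoint_inner_left,
        ← LinearMap.comp_apply, ← b.sum_inner_mul_inner, mul_pow, ← b.sum_sq_norm_inner_right v,
        Finset.mul_sum]
      refine Finset.sum_le_sum fun i _ => ?_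
      have h2 : inner ℝ ((T.adjoint ∘ₗ T) v) (b i) =
          (T.singularValues i) ^ 2 * inner ℝ v (b i) := by
        rw [hS v (b i), hS.apply_eigenvectorBasis hfr i, inner_smul_right,
          T.sq_singularValues_fin hfr i]
        simp [b]
      rw [h2, real_inner_comm v (b i), mul_assoc, ← sq, Real.norm_eq_abs, sq_abs]
      have h3 : T.singularValues i ≤ T.singularValues 0 := T.singularValues_antitone (Nat.zero_le _)
      have h4 := T.singularValues_nonneg i
      gcongr
    exact (sq_le_sq₀ (norm_nonneg _)
      (mul_nonneg (T.singularValues_nonneg 0) (norm_nonneg _))).1 h1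

/-- `𝓜(ρ, r)`: the `M × M` matrices of rank at most `r` with `‖Q‖_{S_∞} ≤ ρ`. -/
def lowRankBall (M : ℕ) (ρ : ℝ) (r : ℕ) : Set (Matrix (Fin M) (Fin M) ℝ) :=
  {Q | Q.rank ≤ r ∧ schattenInf Q ≤ ρ}

/-- `π` is a stationary distribution of the chain `x ↦ A x + ξ`, where the noise `ξ` has law `ν`:
if `X ∼ π` and `ξ ∼ ν` are independent, then `A X + ξ ∼ π`. -/
def IsStationaryLaw {M : ℕ} (A : Matrix (Fin M) (Fin M) ℝ)
    (ν π : Measure (EuclideanSpace ℝ (Fin M))) : Prop :=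
  (π.prod ν).map (fun p => Matrix.toEuclideanLin A p.1 + p.2) = π

/-- `(X_t)_{t ≥ 1}` is a stationary vector autoregressive process with transition matrix `A` and
i.i.d. centered noise `(ξ_t)_{t ≥ 2}`: `X_1` follows the stationary distribution, is independent
of the noise, and `X_t = A X_{t-1} + ξ_t` for `t ≥ 2`. The values `X 0`, `ξ 0` and `ξ 1` are not
used. -/
structure IsStationaryVAR {Ω : Type*} [MeasurableSpace Ω] (μ : Measure Ω) {M : ℕ}
    (A : Matrix (Fin M) (Fin M) ℝ) (X ξ : ℕ → Ω → EuclideanSpace ℝ (Fin M)) : Prop where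
  measurable_process : ∀ t, 1 ≤ t → Measurable (X t)
  measurable_noise : ∀ t, 2 ≤ t → Measurable (ξ t)
  noise_indep : iIndepFun (fun k : ℕ => ξ (k + 2)) μ
  noise_identDistrib : ∀ t, 2 ≤ t → IdentDistrib (ξ t) (ξ 2) μ μ
  noise_integrable : Integrable (ξ 2) μ
  noise_centered : ∫ ω, ξ 2 ω ∂μ = 0
  init_indep : IndepFun (X 1) (fun ω (k : ℕ) => ξ (k + 2) ω) μ
  init_law : IsStationaryLaw A (μ.map (ξ 2)) (μ.map (X 1))
  recursion : ∀ t, 2 ≤ t → ∀ᵐ ω ∂μ, X t ω = Matrix.toEuclideanLin A (X (t - 1) ω) + ξ t ω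

/-- Exponential moments of the coordinates of the noise: `𝔼 exp(|ξ^{(j)}| / c) ≤ d` for all
`j`. -/
def HasExpMoments {Ω : Type*} [MeasurableSpace Ω] (μ : Measure Ω) {M : ℕ}
    (ξ : Ω → EuclideanSpace ℝ (Fin M)) (c d : ℝ) : Prop :=
  ∀ j, Integrable (fun ω => Real.exp (|ξ ω j| / c)) μ ∧ ∫ ω, Real.exp (|ξ ω j| / c) ∂μ ≤ d

/-- The loss `ℓ(X_t - Q X_{t-1})` of the prediction of `X_t` by `Q X_{t-1}`. -/
noncomputable def predLoss {Ω : Type*} {M : ℕ} (ℓ : EuclideanSpace ℝ (Fin M) → ℝ)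
    (X : ℕ → Ω → EuclideanSpace ℝ (Fin M)) (t : ℕ) (Q : Matrix (Fin M) (Fin M) ℝ) (ω : Ω) : ℝ :=
  ℓ (X t ω - Matrix.toEuclideanLin Q (X (t - 1) ω))

/-- The generalization error `R(Q) = 𝔼 ℓ(X_t - Q X_{t-1})`, computed at time `t ≥ 2` (for a
stationary process it does not depend on `t`). -/
noncomputable def genError {Ω : Type*} [MeasurableSpace Ω] (μ : Measure Ω) {M : ℕ}
    (ℓ : EuclideanSpace ℝ (Fin M) → ℝ) (X : ℕ → Ω → EuclideanSpace ℝ (Fin M)) (t : ℕ)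
    (Q : Matrix (Fin M) (Fin M) ℝ) : ℝ :=
  ∫ ω, predLoss ℓ X t Q ω ∂μ

/-- The empirical error `R_n(Q) = (n - 1)⁻¹ ∑_{i=2}^n ℓ(X_i - Q X_{i-1})`. -/
noncomputable def empError {Ω : Type*} {M : ℕ} (ℓ : EuclideanSpace ℝ (Fin M) → ℝ)
    (X : ℕ → Ω → EuclideanSpace ℝ (Fin M)) (n : ℕ) (Q : Matrix (Fin M) (Fin M) ℝ) (ω : Ω) : ℝ :=
  1 / ((n : ℝ) - 1) * ∑ i ∈ Finset.Icc 2 n, predLoss ℓ X i Q ω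

/-- `Ahat` is a rank `r` empirical risk minimizer over `𝓜(ρ, r)` (no measurability of the
selection is required). -/
def IsFixedRankEstimator {Ω : Type*} {M : ℕ} (ℓ : EuclideanSpace ℝ (Fin M) → ℝ)
    (X : ℕ → Ω → EuclideanSpace ℝ (Fin M)) (n : ℕ) (ρ : ℝ) (r : ℕ)
    (Ahat : Ω → Matrix (Fin M) (Fin M) ℝ) : Prop :=
  ∀ ω, Ahat ω ∈ lowRankBall M ρ r ∧
    ∀ Q ∈ lowRankBall M ρ r, empError ℓ X n (Ahat ω) ω ≤ empError ℓ X n Q ω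

/-- `𝓥₀ = 8 e c² d (2 - ρ) / (1 - ρ)³`. -/
noncomputable def calV₀ (c d ρ : ℝ) : ℝ :=
  8 * Real.exp 1 * c ^ 2 * d * (2 - ρ) / (1 - ρ) ^ 3

/-- `δ₀ = 2 c / (1 - ρ)`. -/
noncomputable def delta₀ (c ρ : ℝ) : ℝ := 2 * c / (1 - ρ)

/-! The estimator minimizes the empirical risk, so its excess risk is at most twice the uniform
deviation between empirical and true risk over the low rank ball. The work lies in bounding that
deviation (`IsStationaryVAR.exists_uniform_deviation_event`).

For a fixed `Q` the losses are costs `φ(X_{t-1}, X_t)` of a contracting Markov chain. Let `V_m(x)`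
be the expected cost of `m` steps from `x` (`valueFun`). Partial sums plus `V_{N-k}(y_k)`, minus
`V_N(y_0)`, form a martingale whose increments are centred Lipschitz functions of the fresh noise.
Since `‖A‖ ≤ ρ < 1`, the Lipschitz constant `K` of `V_m` does not depend on `m`. A Chernoff bound
then needs only an exponential moment of `‖ξ‖`, which holds at scale `c√M`
(`HasExpMoments.integrable_exp_norm`). Integrating `V_N` against the stationary law gives `N` times
the risk, so `V_N(X_1)` differs from that number by a term not growing with `N`, for which a first
moment suffices.

Matrices of rank at most `r` factor as `UV` with bounded entries
(`exists_factorization_of_rank_le`), so a grid on the `2Mr` entries yields a net of radius `2/n`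
with log-cardinality of order `Mr log n`. The union bound costs `√(Mr log n / n)` and the noise
scale another `√M`, whence `√(rM² log n / n)`. -/

/-! ### Moment generating functions of Lipschitz functions of the noise. -/

/-- The Taylor remainder is at most `x² exp |x|`, and `w² ≤ 2 exp w` absorbs the square. Keeping
`t²` outside the exponential makes the later Chernoff bound quadratic in the parameter. -/
theorem Real.exp_le_one_add_add_two_mul_sq_mul_exp {x t w : ℝ} (ht1 : t ≤ 1)
    (hw : 0 ≤ w) (hx : |x| ≤ t * w) :
    Real.exp x ≤ 1 + x + 2 * t ^ 2 * Real.exp (2 * w) := by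
  have h1 : |Real.exp x - (1 + x)| ≤ |x| ^ 2 * Real.exp |x| := by
    have := Complex.norm_exp_sub_sum_le_norm_mul_exp (x : ℂ) 2
    simp only [Finset.sum_range_succ, Finset.sum_range_zero, pow_zero, Nat.factorial, zero_add,
      Nat.cast_one, div_one, pow_one, Complex.norm_real, Real.norm_eq_abs, mul_one] at this
    rw [← Complex.ofReal_exp, ← Complex.ofReal_one, ← Complex.ofReal_add, ← Complex.ofReal_sub,
      Complex.norm_real, Real.norm_eq_abs] at this
    exact this
  have h2 : |x| ^ 2 ≤ t ^ 2 * w ^ 2 := by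
    rw [← mul_pow]; exact pow_le_pow_left₀ (abs_nonneg _) hx 2
  have h3 : Real.exp |x| ≤ Real.exp w :=
    Real.exp_le_exp.2 (hx.trans (mul_le_of_le_one_left hw ht1))
  have h4 : w ^ 2 ≤ 2 * Real.exp w := by
    have := Real.quadratic_le_exp_of_nonneg hw
    nlinarith
  have h5 : |x| ^ 2 * Real.exp |x| ≤ t ^ 2 * (2 * Real.exp w) * Real.exp w :=
    mul_le_mul (h2.trans (by gcongr)) h3 (Real.exp_pos _).le (by positivity)
  have h6 : Real.exp (2 * w) = Real.exp w * Real.exp w := by rw [two_mul, Real.exp_add]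
  have := le_abs_self (Real.exp x - (1 + x))
  rw [h6]
  nlinarith

section Noise

variable {E : Type*} [NormedAddCommGroup E]

theorem continuous_of_abs_sub_le_mul_norm {g : E → ℝ} {K : ℝ}
    (hg : ∀ x y, |g x - g y| ≤ K * ‖x - y‖) : Continuous g := by
  refine (LipschitzWith.of_dist_le_mul (K := K.toNNReal) fun x y => ?_).continuous
  rw [Real.dist_eq, dist_eq_norm]
  refine (hg x y).trans ?_
  gcongr
  exact Real.le_coe_toNNReal K

variable [MeasurableSpace E] [BorelSpace E]
  {ν : Measure E}

theorem integrable_of_abs_sub_le_mul_norm [IsFiniteMeasure ν]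
    (hν : Integrable (fun z => ‖z‖) ν) {g : E → ℝ} {K : ℝ}
    (hg : ∀ x y, |g x - g y| ≤ K * ‖x - y‖) : Integrable g ν := by
  refine ((hν.const_mul K).add (integrable_const |g 0|)).mono'
    (continuous_of_abs_sub_le_mul_norm hg).aestronglyMeasurable (ae_of_all _ fun z => ?_)
  have h1 := hg z 0
  have h2 := abs_sub_abs_le_abs_sub (g z) (g 0)
  simp only [sub_zero, Real.norm_eq_abs, Pi.add_apply] at *
  linarith

/-- The mean is compared with `g z` through an independent copy. It serves twice: for the noise law
and for the stationary law. -/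
theorem abs_sub_integral_le [IsProbabilityMeasure ν] (hν : Integrable (fun z => ‖z‖) ν)
    {g : E → ℝ} {K : ℝ} (hK : 0 ≤ K)
    (hg : ∀ x y, |g x - g y| ≤ K * ‖x - y‖) (z : E) :
    |g z - ∫ y, g y ∂ν| ≤ K * (‖z‖ + ∫ y, ‖y‖ ∂ν) := by
  have hgi := integrable_of_abs_sub_le_mul_norm hν hg
  have h1 : g z - ∫ y, g y ∂ν = ∫ y, (g z - g y) ∂ν := by
    rw [integral_sub (integrable_const _) hgi]; simp
  have h2 : K * (‖z‖ + ∫ y, ‖y‖ ∂ν) = ∫ y, K * (‖z‖ + ‖y‖) ∂ν := by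
    rw [integral_const_mul, integral_add (integrable_const _) hν]; simp
  rw [h1, h2]
  refine abs_integral_le_integral_abs.trans (integral_mono ?_ ?_ fun y => ?_)
  · exact ((integrable_const _).sub hgi).abs
  · exact ((integrable_const _).add hν).const_mul K
  · exact (hg z y).trans (mul_le_mul_of_nonneg_left (norm_sub_le _ _) hK)

variable {s B : ℝ}

theorem integrable_norm_of_integrable_exp (hs : 0 < s)
    (hi : Integrable (fun z => Real.exp (‖z‖ / s)) ν) : Integrable (fun z => ‖z‖) ν := by
  refine (hi.const_mul s).mono' continuous_norm.aestronglyMeasurable (ae_of_all _ fun z => ?_)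
  have := Real.add_one_le_exp (‖z‖ / s)
  rw [norm_norm, ← div_le_iff₀' hs]
  linarith

theorem integral_norm_le_of_integral_exp_le (hs : 0 < s)
    (hi : Integrable (fun z => Real.exp (‖z‖ / s)) ν)
    (hB : ∫ z, Real.exp (‖z‖ / s) ∂ν ≤ B) : ∫ z, ‖z‖ ∂ν ≤ s * B := by
  refine le_trans ?_ (mul_le_mul_of_nonneg_left hB hs.le)
  rw [← integral_const_mul]
  refine integral_mono (integrable_norm_of_integrable_exp hs hi) (hi.const_mul s) fun z => ?_
  have := Real.add_one_le_exp (‖z‖ / s)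
  change ‖z‖ ≤ s * Real.exp (‖z‖ / s)
  rw [← div_le_iff₀' hs]
  linarith

/-- Sub-exponential moment generating function bound for Lipschitz functions of a vector with an
exponential moment. -/
theorem lintegral_exp_mul_sub_integral_le [IsProbabilityMeasure ν] (hs : 0 < s)
    (hi : Integrable (fun z => Real.exp (‖z‖ / s)) ν)
    (hB : ∫ z, Real.exp (‖z‖ / s) ∂ν ≤ B) {g : E → ℝ} {K l : ℝ} (hK : 0 ≤ K)
    (hg : ∀ x y, |g x - g y| ≤ K * ‖x - y‖) (hl : 2 * |l| * K * s ≤ 1) :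
    ∫⁻ z, ENNReal.ofReal (Real.exp (l * (g z - ∫ y, g y ∂ν))) ∂ν ≤
      ENNReal.ofReal (Real.exp ((2 * |l| * K * s) ^ 2 * (2 * B * Real.exp B))) := by
  have hν := integrable_norm_of_integrable_exp hs hi
  have hgi := integrable_of_abs_sub_le_mul_norm hν hg
  set m := ∫ y, ‖y‖ ∂ν with hm
  have hm0 : 0 ≤ m := integral_nonneg fun _ => norm_nonneg _
  set t := 2 * |l| * K * s with ht
  have ht0 : 0 ≤ t := by positivity
  have key : ∀ z, Real.exp (l * (g z - ∫ y, g y ∂ν)) ≤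
      1 + l * (g z - ∫ y, g y ∂ν) + 2 * t ^ 2 * Real.exp (m / s) * Real.exp (‖z‖ / s) := by
    intro z
    -- The factor 2 in `t` halves `w`, so that `exp (2w)` is exactly `exp (m/s) * exp (‖z‖/s)`,
    -- whose integral is controlled.
    have h := Real.exp_le_one_add_add_two_mul_sq_mul_exp (x := l * (g z - ∫ y, g y ∂ν))
      (w := (‖z‖ + m) / (2 * s)) hl (by positivity) (by
        have h1 := abs_sub_integral_le hν hK hg z
        rw [abs_mul]
        calc |l| * |g z - ∫ y, g y ∂ν| ≤ |l| * (K * (‖z‖ + m)) := by gcongr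
          _ = t * ((‖z‖ + m) / (2 * s)) := by rw [ht]; field_simp)
    have h2 : 2 * ((‖z‖ + m) / (2 * s)) = m / s + ‖z‖ / s := by field_simp; ring
    rw [h2, Real.exp_add] at h
    linarith
  have hsub : Integrable (fun z => l * (g z - ∫ y, g y ∂ν)) ν :=
    (hgi.sub (integrable_const _)).const_mul l
  have hlin : Integrable (fun z => 1 + l * (g z - ∫ y, g y ∂ν)) ν :=
    (integrable_const _).add hsub
  have hup : Integrable (fun z => 1 + l * (g z - ∫ y, g y ∂ν) +
      2 * t ^ 2 * Real.exp (m / s) * Real.exp (‖z‖ / s)) ν := hlin.add (hi.const_mul _)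
  calc ∫⁻ z, ENNReal.ofReal (Real.exp (l * (g z - ∫ y, g y ∂ν))) ∂ν
      ≤ ∫⁻ z, ENNReal.ofReal (1 + l * (g z - ∫ y, g y ∂ν) +
          2 * t ^ 2 * Real.exp (m / s) * Real.exp (‖z‖ / s)) ∂ν :=
        lintegral_mono fun z => ENNReal.ofReal_le_ofReal (key z)
    _ = ENNReal.ofReal (∫ z, (1 + l * (g z - ∫ y, g y ∂ν) +
          2 * t ^ 2 * Real.exp (m / s) * Real.exp (‖z‖ / s)) ∂ν) :=
        (ofReal_integral_eq_lintegral_ofReal hup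
          (ae_of_all _ fun z => (Real.exp_pos _).le.trans (key z))).symm
    _ ≤ _ := by
        refine ENNReal.ofReal_le_ofReal ?_
        -- The linear term integrates to zero by centring; only `1 + O(t²)` remains, and `1 + x ≤
        -- exp x` concludes.
        rw [integral_add hlin (hi.const_mul _), integral_add (integrable_const _)
          hsub, integral_const_mul, integral_const_mul,
          integral_sub hgi (integrable_const _)]
        simp only [integral_const, probReal_univ, smul_eq_mul, one_mul, sub_self, mul_zero,
          add_zero]
        have h1 : m / s ≤ B := by
          rw [div_le_iff₀' hs]; exact integral_norm_le_of_integral_exp_le hs hi hB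
        have h2 : 2 * t ^ 2 * Real.exp (m / s) * ∫ z, Real.exp (‖z‖ / s) ∂ν ≤
            2 * t ^ 2 * Real.exp B * B := by
          have : 0 ≤ ∫ z, Real.exp (‖z‖ / s) ∂ν := integral_nonneg fun _ => (Real.exp_pos _).le
          gcongr
        have h3 := Real.add_one_le_exp (t ^ 2 * (2 * B * Real.exp B))
        linarith

end Noise

/-! ### Value functions and the martingale decomposition of a cumulative cost. -/

/-- Lipschitz constant of a martingale increment in the fresh noise: 1 from the current cost, `K`
from the future. -/
theorem abs_step_sub_step_le {E : Type*} [NormedAddCommGroup E] {φ : E → E → ℝ} {ρ K : ℝ}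
    {V : E → ℝ} (hV : ∀ x x', |V x - V x'| ≤ K * ‖x - x'‖)
    (hφ : ∀ x y x' y', |φ x y - φ x' y'| ≤ ‖y - y'‖ + ρ * ‖x - x'‖) (x y z z' : E) :
    |(φ x (y + z) + V (y + z)) - (φ x (y + z') + V (y + z'))| ≤ (1 + K) * ‖z - z'‖ := by
  have h1 := hφ x (y + z) x (y + z')
  have h2 := hV (y + z) (y + z')
  simp only [add_sub_add_left_eq_sub, sub_self, norm_zero, mul_zero, add_zero] at h1 h2
  calc _ = |(φ x (y + z) - φ x (y + z')) + (V (y + z) - V (y + z'))| := by congr 1; ring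
    _ ≤ _ := (abs_add_le _ _).trans (by linarith)

theorem continuous_cost {E : Type*} [NormedAddCommGroup E] {φ : E → E → ℝ} {ρ : ℝ}
    (hφ : ∀ x y x' y', |φ x y - φ x' y'| ≤ ‖y - y'‖ + ρ * ‖x - x'‖) :
    Continuous (fun p : E × E => φ p.1 p.2) := by
  refine continuous_of_abs_sub_le_mul_norm (K := 1 + |ρ|) fun p q => ?_
  have h1 : ‖p.2 - q.2‖ ≤ ‖p - q‖ := norm_snd_le (p - q)
  have h2 : ‖p.1 - q.1‖ ≤ ‖p - q‖ := norm_fst_le (p - q)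
  have h3 : ρ * ‖p.1 - q.1‖ ≤ |ρ| * ‖p - q‖ :=
    mul_le_mul (le_abs_self _) h2 (norm_nonneg _) (abs_nonneg _)
  have := hφ p.1 p.2 q.1 q.2
  linarith

/-- One step of the exponential supermartingale argument. -/
theorem lintegral_exp_mul_add_le {E Ω : Type*} [MeasurableSpace E] [MeasurableSpace Ω]
    {μ : Measure Ω} [IsProbabilityMeasure μ] {S : Ω → ℝ} {y z : Ω → E} {h : E → E → ℝ} {l C : ℝ}
    (hS : Measurable S) (hy : Measurable y) (hz : Measurable z) (hh : Measurable h.uncurry)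
    (hind : IndepFun (fun ω => (S ω, y ω)) z μ)
    (hC : ∀ x, ∫⁻ v, ENNReal.ofReal (Real.exp (l * h x v)) ∂(μ.map z) ≤ ENNReal.ofReal C) :
    ∫⁻ ω, ENNReal.ofReal (Real.exp (l * (S ω + h (y ω) (z ω)))) ∂μ ≤
      (∫⁻ ω, ENNReal.ofReal (Real.exp (l * S ω)) ∂μ) * ENNReal.ofReal C := by
  have hSy : Measurable fun ω => (S ω, y ω) := hS.prodMk hy
  have hlaw := hind.map_prod_eq_prod_map_map hSy.aemeasurable hz.aemeasurable
  have : IsProbabilityMeasure (μ.map z) := Measure.isProbabilityMeasure_map hz.aemeasurable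
  have hh' : Measurable fun q : (ℝ × E) × E => h q.1.2 q.2 :=
    hh.comp ((measurable_snd.comp measurable_fst).prodMk measurable_snd)
  calc ∫⁻ ω, ENNReal.ofReal (Real.exp (l * (S ω + h (y ω) (z ω)))) ∂μ
      = ∫⁻ q, ENNReal.ofReal (Real.exp (l * (q.1.1 + h q.1.2 q.2)))
          ∂(μ.map fun ω => ((S ω, y ω), z ω)) := by
        rw [lintegral_map (by fun_prop) (hSy.prodMk hz)]
    _ = ∫⁻ p, ∫⁻ v, ENNReal.ofReal (Real.exp (l * (p.1 + h p.2 v))) ∂(μ.map z)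
          ∂(μ.map fun ω => (S ω, y ω)) := by
        rw [hlaw, lintegral_prod _ (by fun_prop)]
    _ = ∫⁻ p, ENNReal.ofReal (Real.exp (l * p.1)) *
          ∫⁻ v, ENNReal.ofReal (Real.exp (l * h p.2 v)) ∂(μ.map z)
          ∂(μ.map fun ω => (S ω, y ω)) := by
        refine lintegral_congr fun p => ?_
        have : Measurable fun v => h p.2 v := hh.comp measurable_prodMk_left
        rw [← lintegral_const_mul _ (by fun_prop)]
        refine lintegral_congr fun v => ?_
        rw [← ENNReal.ofReal_mul (Real.exp_pos _).le, ← Real.exp_add, mul_add]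
    _ ≤ ∫⁻ p, ENNReal.ofReal (Real.exp (l * p.1)) * ENNReal.ofReal C
          ∂(μ.map fun ω => (S ω, y ω)) := by
        gcongr with p
        exact hC _
    _ = _ := by
        rw [lintegral_mul_const _ (by fun_prop), lintegral_map (by fun_prop) hSy]

section Value

variable {E : Type*} [NormedAddCommGroup E] [NormedSpace ℝ E] [MeasurableSpace E]

/-- Expected cumulative cost `𝔼 ∑_{i < m} φ(x_i, x_{i+1})` of the chain `x_{i+1} = A x_i + z_i`
started at `x_0 = x`, the `z_i` being i.i.d. with law `ν`. -/
noncomputable def valueFun (ν : Measure E) (A : E →L[ℝ] E) (φ : E → E → ℝ) : ℕ → E → ℝ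
  | 0, _ => 0
  | m + 1, x => ∫ z, (φ x (A x + z) + valueFun ν A φ m (A x + z)) ∂ν

variable [BorelSpace E] {ν : Measure E} [IsProbabilityMeasure ν] {A : E →L[ℝ] E} {φ : E → E → ℝ}
  {ρ K : ℝ}

/-- Couple two chains by the same noise: after one step their distance is at most `ρ‖x - x'‖`. The
current cost contributes `2ρ` and the future `Kρ`, so any `K` with `(2 + K)ρ ≤ K` is preserved by
induction, whatever the horizon. -/
theorem abs_valueFun_sub_le (hν : Integrable (fun z => ‖z‖) ν) (hK : 0 ≤ K)
    (hρK : (2 + K) * ρ ≤ K) (hA : ‖A‖ ≤ ρ)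
    (hφ : ∀ x y x' y', |φ x y - φ x' y'| ≤ ‖y - y'‖ + ρ * ‖x - x'‖) (m : ℕ) :
    ∀ x x', |valueFun ν A φ m x - valueFun ν A φ m x'| ≤ K * ‖x - x'‖ := by
  induction m with
  | zero => intro x x'; simp only [valueFun, sub_self, abs_zero]; positivity
  | succ m ih =>
    intro x x'
    have hint : ∀ x, Integrable (fun z => φ x (A x + z) + valueFun ν A φ m (A x + z)) ν :=
      fun x => integrable_of_abs_sub_le_mul_norm hν fun z z' =>
        abs_step_sub_step_le (ρ := ρ) ih hφ x (A x) z z'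
    simp only [valueFun]
    rw [← integral_sub (hint x) (hint x')]
    refine abs_integral_le_integral_abs.trans ?_
    calc ∫ z, |φ x (A x + z) + valueFun ν A φ m (A x + z) -
          (φ x' (A x' + z) + valueFun ν A φ m (A x' + z))| ∂ν
        ≤ ∫ _, K * ‖x - x'‖ ∂ν := by
          refine integral_mono ((hint x).sub (hint x')).abs (integrable_const _) fun z => ?_
          have h1 := hφ x (A x + z) x' (A x' + z)
          have h2 := ih (A x + z) (A x' + z)
          simp only [add_sub_add_right_eq_sub, ← map_sub] at h1 h2
          have h3 : ‖A (x - x')‖ ≤ ρ * ‖x - x'‖ := A.le_of_opNorm_le hA _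
          have h4 : K * ‖A (x - x')‖ ≤ K * (ρ * ‖x - x'‖) := by gcongr
          have h5 := mul_le_mul_of_nonneg_right hρK (norm_nonneg (x - x'))
          calc _ = |(φ x (A x + z) - φ x' (A x' + z)) +
                (valueFun ν A φ m (A x + z) - valueFun ν A φ m (A x' + z))| := by
                  congr 1; ring
            _ ≤ _ := (abs_add_le _ _).trans (by linarith)
      _ = _ := by simp

theorem continuous_valueFun (hν : Integrable (fun z => ‖z‖) ν) (hK : 0 ≤ K)
    (hρK : (2 + K) * ρ ≤ K) (hA : ‖A‖ ≤ ρ)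
    (hφ : ∀ x y x' y', |φ x y - φ x' y'| ≤ ‖y - y'‖ + ρ * ‖x - x'‖) (m : ℕ) :
    Continuous (valueFun ν A φ m) :=
  continuous_of_abs_sub_le_mul_norm (abs_valueFun_sub_le hν hK hρK hA hφ m)

variable [SecondCountableTopology E] {Ω : Type*} [mΩ : MeasurableSpace Ω] {μ : Measure Ω}
  [IsProbabilityMeasure μ] {F : ℕ → MeasurableSpace Ω} {y z : ℕ → Ω → E} {s B : ℝ}

/-- The increment `h` is centred in the noise because `valueFun` at horizon `m + 1` is by definition
the mean of its first two terms; each step thus multiplies the exponential moment by at most a fixed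
constant. Subtracting `V_N(y_0)` removes any need for exponential moments of the initial state. -/
theorem lintegral_exp_sum_sub_valueFun_le (hF : ∀ k, F k ≤ mΩ) (hmono : Monotone F)
    (hy : ∀ k, Measurable[F k] (y k)) (hz : ∀ k, Measurable (z k))
    (hind : ∀ k, Indep (F k) (MeasurableSpace.comap (z k) inferInstance) μ)
    (hrec : ∀ k ω, y (k + 1) ω = A (y k ω) + z k ω) (hlaw : ∀ k, μ.map (z k) = ν)
    (hs : 0 < s) (hi : Integrable (fun z => Real.exp (‖z‖ / s)) ν)
    (hB : ∫ z, Real.exp (‖z‖ / s) ∂ν ≤ B) (hK : 0 ≤ K) (hρK : (2 + K) * ρ ≤ K) (hA : ‖A‖ ≤ ρ)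
    (hφ : ∀ x y x' y', |φ x y - φ x' y'| ≤ ‖y - y'‖ + ρ * ‖x - x'‖) {l : ℝ}
    (hl : 2 * |l| * (1 + K) * s ≤ 1) (N k : ℕ) (hk : k ≤ N) :
    ∫⁻ ω, ENNReal.ofReal (Real.exp (l * (∑ i ∈ Finset.range k, φ (y i ω) (y (i + 1) ω) +
      valueFun ν A φ (N - k) (y k ω) - valueFun ν A φ N (y 0 ω)))) ∂μ ≤
      ENNReal.ofReal (Real.exp ((2 * |l| * (1 + K) * s) ^ 2 * (2 * B * Real.exp B))) ^ k := by
  have hν := integrable_norm_of_integrable_exp hs hi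
  have hVc := continuous_valueFun (K := K) (ρ := ρ) hν hK hρK hA hφ
  have hφc := continuous_cost hφ
  have hyk : ∀ i k, i ≤ k → Measurable[F k] (y i) := fun i k h => (hy i).mono (hmono h) le_rfl
  have hym : ∀ i, Measurable (y i) := fun i => (hy i).mono (hF i) le_rfl
  induction k with
  | zero => simp
  | succ k ih =>
    set S : Ω → ℝ := fun ω => ∑ i ∈ Finset.range k, φ (y i ω) (y (i + 1) ω) +
      valueFun ν A φ (N - k) (y k ω) - valueFun ν A φ N (y 0 ω) with hS
    set m := N - (k + 1) with hm
    have hNk : N - k = m + 1 := by omega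
    set h : E → E → ℝ := fun x v => φ x (A x + v) + valueFun ν A φ m (A x + v) -
      valueFun ν A φ (m + 1) x with hh
    have hSF : Measurable[F k] S := by
      refine Measurable.sub (Measurable.add (Finset.measurable_sum _ fun i hi => ?_) ?_) ?_
      · have hi' := Finset.mem_range.1 hi
        exact hφc.measurable.comp ((hyk i k hi'.le).prodMk (hyk (i + 1) k hi'))
      · exact (hVc _).measurable.comp (hyk k k le_rfl)
      · exact (hVc _).measurable.comp (hyk 0 k (Nat.zero_le _))
    have hcont : Continuous h.uncurry := by
      have h1 : Continuous fun p : E × E => A p.1 + p.2 := by fun_prop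
      exact ((hφc.comp (continuous_fst.prodMk h1)).add ((hVc m).comp h1)).sub
        ((hVc (m + 1)).comp continuous_fst)
    have hstep := lintegral_exp_mul_add_le (μ := μ) (S := S) (y := y k) (z := z k) (h := h)
      (l := l) (hSF.mono (hF k) le_rfl) (hym k) (hz k) hcont.measurable
      (by
        rw [IndepFun_iff_Indep]
        refine indep_of_indep_of_le_left (hind k) ?_
        exact Measurable.comap_le (hSF.prodMk (hyk k k le_rfl)))
      (C := Real.exp ((2 * |l| * (1 + K) * s) ^ 2 * (2 * B * Real.exp B)))
      (by
        intro x
        rw [hlaw]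
        exact lintegral_exp_mul_sub_integral_le hs hi hB (by linarith)
          (fun v v' => abs_step_sub_step_le (ρ := ρ)
            (abs_valueFun_sub_le hν hK hρK hA hφ m) hφ x (A x) v v') hl)
    rw [pow_succ]
    refine le_trans (le_of_eq ?_) (hstep.trans (by gcongr; exact ih (by omega)))
    refine lintegral_congr fun ω => ?_
    have : ∑ i ∈ Finset.range (k + 1), φ (y i ω) (y (i + 1) ω) +
        valueFun ν A φ m (y (k + 1) ω) - valueFun ν A φ N (y 0 ω) =
        S ω + h (y k ω) (z k ω) := by
      simp only [hS, hh, hNk, Finset.sum_range_succ, ← hrec]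
      ring
    rw [this]

/-- Two-sided deviation bound. -/
theorem measure_abs_sum_sub_valueFun_ge_le (hF : ∀ k, F k ≤ mΩ) (hmono : Monotone F)
    (hy : ∀ k, Measurable[F k] (y k)) (hz : ∀ k, Measurable (z k))
    (hind : ∀ k, Indep (F k) (MeasurableSpace.comap (z k) inferInstance) μ)
    (hrec : ∀ k ω, y (k + 1) ω = A (y k ω) + z k ω) (hlaw : ∀ k, μ.map (z k) = ν)
    (hs : 0 < s) (hi : Integrable (fun z => Real.exp (‖z‖ / s)) ν)
    (hB : ∫ z, Real.exp (‖z‖ / s) ∂ν ≤ B) (hK : 0 ≤ K) (hρK : (2 + K) * ρ ≤ K) (hA : ‖A‖ ≤ ρ)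
    (hφ : ∀ x y x' y', |φ x y - φ x' y'| ≤ ‖y - y'‖ + ρ * ‖x - x'‖) {t : ℝ} (ht0 : 0 ≤ t)
    (ht1 : t ≤ 1) (N : ℕ) (u : ℝ) :
    μ {ω | 2 * (1 + K) * s * u ≤ |∑ i ∈ Finset.range N, φ (y i ω) (y (i + 1) ω) -
        valueFun ν A φ N (y 0 ω)|} ≤
      ENNReal.ofReal (2 * Real.exp (N * (t ^ 2 * (2 * B * Real.exp B)) - t * u)) := by
  have hν := integrable_norm_of_integrable_exp hs hi
  have hVc := continuous_valueFun (K := K) (ρ := ρ) hν hK hρK hA hφ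
  have hφc := continuous_cost hφ
  have hym : ∀ i, Measurable (y i) := fun i => (hy i).mono (hF i) le_rfl
  set S : Ω → ℝ := fun ω => ∑ i ∈ Finset.range N, φ (y i ω) (y (i + 1) ω) -
        valueFun ν A φ N (y 0 ω) with hS
  have hSm : Measurable S :=
    Measurable.sub (Finset.measurable_sum _ fun i _ =>
      hφc.measurable.comp ((hym i).prodMk (hym (i + 1)))) ((hVc _).measurable.comp (hym 0))
  have hc : 0 < 2 * (1 + K) * s := by positivity
  have one : ∀ e : ℝ, |e| = 1 → μ {ω | 2 * (1 + K) * s * u ≤ e * S ω} ≤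
      ENNReal.ofReal (Real.exp (N * (t ^ 2 * (2 * B * Real.exp B)) - t * u)) := by
    intro e he
    -- Normalized so that `2 * |l| * (1 + K) * s = t`; the sign `e` selects the tail.
    set l := e * (t / (2 * (1 + K) * s)) with hldef
    have hl : 2 * |l| * (1 + K) * s = t := by
      rw [hldef, abs_mul, he, abs_of_nonneg (by positivity)]; field_simp
    have h1 := lintegral_exp_sum_sub_valueFun_le (l := l) hF hmono hy hz hind hrec hlaw hs hi hB
      hK hρK hA hφ (by rw [hl]; exact ht1) N N le_rfl
    simp only [Nat.sub_self, valueFun, add_zero, hl] at h1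
    have h2 := mul_meas_ge_le_lintegral (μ := μ)
      (f := fun ω => ENNReal.ofReal (Real.exp (l * S ω))) (by fun_prop)
      (ENNReal.ofReal (Real.exp (t * u)))
    have h3 : {ω | 2 * (1 + K) * s * u ≤ e * S ω} ⊆
        {ω | ENNReal.ofReal (Real.exp (t * u)) ≤ ENNReal.ofReal (Real.exp (l * S ω))} := by
      intro ω hω
      simp only [Set.mem_ofPred_eq] at hω ⊢
      refine ENNReal.ofReal_le_ofReal (Real.exp_le_exp.2 ?_)
      have : l * S ω = t / (2 * (1 + K) * s) * (e * S ω) := by rw [hldef]; ring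
      rw [this]
      calc t * u = t / (2 * (1 + K) * s) * (2 * (1 + K) * s * u) := by field_simp
        _ ≤ _ := by gcongr
    have h4 : ENNReal.ofReal (Real.exp (t * u)) * μ {ω | 2 * (1 + K) * s * u ≤ e * S ω} ≤
        ENNReal.ofReal (Real.exp (t ^ 2 * (2 * B * Real.exp B))) ^ N :=
      (mul_le_mul_right (measure_mono h3) _).trans (h2.trans h1)
    rw [← ENNReal.ofReal_pow (Real.exp_pos _).le, ← Real.exp_nat_mul] at h4
    rw [Real.exp_sub, ENNReal.ofReal_div_of_pos (Real.exp_pos _),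
      ENNReal.le_div_iff_mul_le (Or.inl (by simp [Real.exp_pos])) (Or.inl (by simp)), mul_comm]
    exact h4
  have hsub : {ω | 2 * (1 + K) * s * u ≤ |S ω|} ⊆
      {ω | 2 * (1 + K) * s * u ≤ 1 * S ω} ∪ {ω | 2 * (1 + K) * s * u ≤ (-1) * S ω} := by
    intro ω hω
    simp only [Set.mem_union, Set.mem_ofPred_eq, one_mul, neg_mul] at hω ⊢
    exact le_abs.1 hω
  rw [two_mul (Real.exp _), ENNReal.ofReal_add (Real.exp_pos _).le (Real.exp_pos _).le]
  exact (measure_mono hsub).trans ((measure_union_le _ _).trans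
    (add_le_add (one 1 (by simp)) (one (-1) (by simp))))

end Value

/-! ### First moment of the stationary law and centring of the value function. -/

section Stationary

variable {E : Type*} [NormedAddCommGroup E] [NormedSpace ℝ E] [MeasurableSpace E] [BorelSpace E]
  [SecondCountableTopology E] {ν π : Measure E} [IsProbabilityMeasure ν] [IsProbabilityMeasure π]
  {A : E →L[ℝ] E}

/-- Stationarity gives `𝔼‖X‖ ≤ r 𝔼‖X‖ + 𝔼‖ξ‖`, which cannot be rearranged before `𝔼‖X‖` is known to
be finite. Hence the norm is truncated at `b`, the inequality iterated, and `k → ∞` taken by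
domination; then `b → ∞` by monotone convergence. -/
theorem lintegral_enorm_le_of_stationary {r : ℝ≥0} (hr : r < 1) (hA : ‖A‖₊ ≤ r)
    (hπ : (π.prod ν).map (fun p => A p.1 + p.2) = π) :
    ∫⁻ x, ‖x‖ₑ ∂π ≤ (1 - (r : ℝ≥0∞))⁻¹ * ∫⁻ z, ‖z‖ₑ ∂ν := by
  set m := ∫⁻ z, ‖z‖ₑ ∂ν
  have hf : Measurable fun p : E × E => A p.1 + p.2 := by fun_prop
  have step : ∀ (b : ℕ) (k : ℕ), ∫⁻ x, min ((r : ℝ≥0∞) ^ k * ‖x‖ₑ) b ∂π ≤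
      ∫⁻ x, min ((r : ℝ≥0∞) ^ (k + 1) * ‖x‖ₑ) b ∂π + (r : ℝ≥0∞) ^ k * m := by
    intro b k
    calc ∫⁻ x, min ((r : ℝ≥0∞) ^ k * ‖x‖ₑ) b ∂π
        = ∫⁻ p, min ((r : ℝ≥0∞) ^ k * ‖A p.1 + p.2‖ₑ) b ∂(π.prod ν) := by
          conv_lhs => rw [← hπ]
          rw [lintegral_map (by fun_prop) hf]
      _ ≤ ∫⁻ p, (min ((r : ℝ≥0∞) ^ (k + 1) * ‖p.1‖ₑ) b + (r : ℝ≥0∞) ^ k * ‖p.2‖ₑ)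
            ∂(π.prod ν) := by
          refine lintegral_mono fun p => ?_
          have h1 : ‖A p.1 + p.2‖ₑ ≤ r * ‖p.1‖ₑ + ‖p.2‖ₑ := by
            refine (enorm_add_le _ _).trans (add_le_add_left ?_ _)
            have : ‖A p.1‖₊ ≤ r * ‖p.1‖₊ := (A.le_opNNNorm _).trans (by gcongr)
            simpa [enorm_eq_nnnorm] using (ENNReal.coe_le_coe.2 this)
          have h2 : (r : ℝ≥0∞) ^ k * ‖A p.1 + p.2‖ₑ ≤
              (r : ℝ≥0∞) ^ (k + 1) * ‖p.1‖ₑ + (r : ℝ≥0∞) ^ k * ‖p.2‖ₑ := by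
            calc _ ≤ (r : ℝ≥0∞) ^ k * (r * ‖p.1‖ₑ + ‖p.2‖ₑ) := by gcongr
              _ = _ := by ring
          rcases le_total ((r : ℝ≥0∞) ^ (k + 1) * ‖p.1‖ₑ) b with h | h
          · rw [min_eq_left h]; exact (min_le_left _ _).trans h2
          · rw [min_eq_right h]; exact (min_le_right _ _).trans le_self_add
      _ = _ := by
          rw [lintegral_add_right _ (by fun_prop),
            lintegral_prod (fun p : E × E => min ((r : ℝ≥0∞) ^ (k + 1) * ‖p.1‖ₑ) (b : ℝ≥0∞))
              (by fun_prop),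
            lintegral_prod (fun p : E × E => (r : ℝ≥0∞) ^ k * ‖p.2‖ₑ) (by fun_prop)]
          simp only [lintegral_const, measure_univ, mul_one]
          rw [lintegral_const_mul _ (by fun_prop)]
  have iter : ∀ (b : ℕ) (k : ℕ), ∫⁻ x, min ‖x‖ₑ b ∂π ≤
      ∫⁻ x, min ((r : ℝ≥0∞) ^ k * ‖x‖ₑ) b ∂π + (∑ i ∈ Finset.range k, (r : ℝ≥0∞) ^ i) * m := by
    intro b k
    induction k with
    | zero => simp
    | succ k ih =>
      refine ih.trans ?_
      rw [Finset.sum_range_succ, add_mul, add_comm (_ * m), ← add_assoc]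
      gcongr
      exact step b k
  have trunc : ∀ b : ℕ, ∫⁻ x, min ‖x‖ₑ b ∂π ≤ (1 - (r : ℝ≥0∞))⁻¹ * m := by
    intro b
    have hlim : Filter.Tendsto (fun k : ℕ => ∫⁻ x, min ((r : ℝ≥0∞) ^ k * ‖x‖ₑ) b ∂π)
        Filter.atTop (nhds (∫⁻ _, 0 ∂π)) := by
      refine tendsto_lintegral_of_dominated_convergence (fun _ => (b : ℝ≥0∞))
        (fun k => by fun_prop) (fun k => ae_of_all _ fun x => min_le_right _ _) (by simp)
        (ae_of_all _ fun x => ?_)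
      have h1 : Filter.Tendsto (fun k : ℕ => (r : ℝ≥0∞) ^ k * ‖x‖ₑ) Filter.atTop
          (nhds (0 * ‖x‖ₑ)) :=
        ENNReal.Tendsto.mul_const (ENNReal.tendsto_pow_atTop_nhds_zero_of_lt_one
          (by exact_mod_cast hr)) (Or.inr (by simp))
      simpa using h1.min (tendsto_const_nhds (x := (b : ℝ≥0∞)))
    have h2 := hlim.add_const ((1 - (r : ℝ≥0∞))⁻¹ * m)
    rw [lintegral_zero, zero_add] at h2
    refine ge_of_tendsto' h2 fun k => (iter b k).trans ?_
    gcongr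
    rw [← ENNReal.tsum_geometric]
    exact ENNReal.sum_le_tsum _
  refine le_of_tendsto' (lintegral_tendsto_of_tendsto_of_monotone
    (f := fun (b : ℕ) (x : E) => min ‖x‖ₑ (b : ℝ≥0∞)) (F := fun x => ‖x‖ₑ) (fun b => by fun_prop)
    (ae_of_all _ fun x => ?_) (ae_of_all _ fun x => ?_)) trunc
  · intro a b hab
    exact min_le_min_left _ (by exact_mod_cast hab)
  · have := (tendsto_const_nhds (x := ‖x‖ₑ) (f := Filter.atTop)).min
      ENNReal.tendsto_nat_nhds_top
    simpa using this

theorem integrable_norm_of_stationary {ρ : ℝ} (hρ : ρ < 1) (hA : ‖A‖ ≤ ρ)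
    (hπ : (π.prod ν).map (fun p => A p.1 + p.2) = π) (hν : Integrable (fun z => ‖z‖) ν) :
    Integrable (fun x => ‖x‖) π ∧ ∫ x, ‖x‖ ∂π ≤ (∫ z, ‖z‖ ∂ν) / (1 - ρ) := by
  have hρ0 : 0 ≤ ρ := (norm_nonneg _).trans hA
  lift ρ to ℝ≥0 using hρ0
  have hr : ρ < 1 := by exact_mod_cast hρ
  have h := lintegral_enorm_le_of_stationary (r := ρ) hr (by exact_mod_cast hA) hπ
  have hνfin : ∫⁻ z, ‖z‖ₑ ∂ν = ENNReal.ofReal (∫ z, ‖z‖ ∂ν) := by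
    rw [ofReal_integral_eq_lintegral_ofReal hν (ae_of_all _ fun _ => norm_nonneg _)]
    simp
  have hr' : (1 - (ρ : ℝ≥0∞))⁻¹ = ENNReal.ofReal (1 / (1 - (ρ : ℝ))) := by
    rw [one_div, ENNReal.ofReal_inv_of_pos (by linarith), ENNReal.ofReal_sub 1 ρ.coe_nonneg,
      ENNReal.ofReal_one, ENNReal.ofReal_coe_nnreal]
  rw [hνfin, hr', ← ENNReal.ofReal_mul (by have := sub_pos.2 hρ; positivity)] at h
  have hπi : Integrable (fun x => ‖x‖) π := by
    refine ⟨continuous_norm.aestronglyMeasurable, ?_⟩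
    rw [HasFiniteIntegral]
    simp only [enorm_norm]
    exact h.trans_lt ENNReal.ofReal_lt_top
  refine ⟨hπi, ?_⟩
  have h2 : ∫⁻ x, ‖x‖ₑ ∂π = ENNReal.ofReal (∫ x, ‖x‖ ∂π) := by
    rw [ofReal_integral_eq_lintegral_ofReal hπi (ae_of_all _ fun _ => norm_nonneg _)]
    simp
  rw [h2] at h
  have h3 : 0 ≤ ∫ z, ‖z‖ ∂ν := integral_nonneg fun _ => norm_nonneg _
  have h4 := sub_pos.2 hρ
  rw [ENNReal.ofReal_le_ofReal_iff (by positivity)] at h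
  rwa [one_div_mul_eq_div] at h

variable {φ : E → E → ℝ} {ρ K : ℝ}

theorem integrable_cost_prod (hν : Integrable (fun z => ‖z‖) ν) (hπi : Integrable (fun x => ‖x‖) π)
    (hφ : ∀ x y x' y', |φ x y - φ x' y'| ≤ ‖y - y'‖ + ρ * ‖x - x'‖) :
    Integrable (fun p : E × E => φ p.1 (A p.1 + p.2)) (π.prod ν) := by
  have h1 : Integrable (fun p : E × E => ‖p.1‖) (π.prod ν) := hπi.comp_fst ν
  have h2 : Integrable (fun p : E × E => ‖p.2‖) (π.prod ν) := hν.comp_snd π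
  have hA : Continuous fun p : E × E => A p.1 + p.2 := by fun_prop
  have hc : Continuous fun p : E × E => φ p.1 (A p.1 + p.2) :=
    (continuous_cost hφ).comp (continuous_fst.prodMk hA)
  refine ((h1.const_mul (‖A‖ + ρ)).add (h2.add (integrable_const |φ 0 0|))).mono'
    hc.aestronglyMeasurable (ae_of_all _ fun p => ?_)
  have h3 := hφ p.1 (A p.1 + p.2) 0 0
  have h4 := abs_sub_abs_le_abs_sub (φ p.1 (A p.1 + p.2)) (φ 0 0)
  have h5 := norm_add_le (A p.1) p.2
  have h6 := A.le_opNorm p.1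
  simp only [sub_zero, Real.norm_eq_abs, Pi.add_apply] at *
  linarith

theorem integral_valueFun_of_stationary (hν : Integrable (fun z => ‖z‖) ν) (hK : 0 ≤ K)
    (hρK : (2 + K) * ρ ≤ K) (hA : ‖A‖ ≤ ρ)
    (hφ : ∀ x y x' y', |φ x y - φ x' y'| ≤ ‖y - y'‖ + ρ * ‖x - x'‖)
    (hπ : (π.prod ν).map (fun p => A p.1 + p.2) = π) (hπi : Integrable (fun x => ‖x‖) π) (m : ℕ) :
    ∫ x, valueFun ν A φ m x ∂π = m * ∫ p, φ p.1 (A p.1 + p.2) ∂(π.prod ν) := by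
  have hf : Measurable fun p : E × E => A p.1 + p.2 := by fun_prop
  induction m with
  | zero => simp [valueFun]
  | succ m ih =>
    have hVi := integrable_of_abs_sub_le_mul_norm hπi (abs_valueFun_sub_le hν hK hρK hA hφ m)
    have hVc := (continuous_valueFun (K := K) hν hK hρK hA hφ m)
    have hVp : Integrable (fun p : E × E => valueFun ν A φ m (A p.1 + p.2)) (π.prod ν) := by
      rw [← hπ] at hVi
      exact hVi.comp_measurable hf
    have hφp := integrable_cost_prod (A := A) hν hπi hφ
    have h1 : ∫ x, valueFun ν A φ (m + 1) x ∂π =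
        ∫ p : E × E, (φ p.1 (A p.1 + p.2) + valueFun ν A φ m (A p.1 + p.2)) ∂(π.prod ν) :=
      (integral_prod _ (hφp.add hVp)).symm
    rw [h1, integral_add hφp hVp]
    have h2 : ∫ p : E × E, valueFun ν A φ m (A p.1 + p.2) ∂(π.prod ν) =
        ∫ x, valueFun ν A φ m x ∂π := by
      conv_rhs => rw [← hπ]
      rw [integral_map hf.aemeasurable hVc.aestronglyMeasurable]
    rw [h2, ih]
    push_cast
    ring

/-- The bound does not grow with `m`: after division by the sample size the effect of the initial
state is of order `1/n`. -/
theorem abs_valueFun_sub_mul_integral_le (hν : Integrable (fun z => ‖z‖) ν) (hK : 0 ≤ K)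
    (hρK : (2 + K) * ρ ≤ K) (hA : ‖A‖ ≤ ρ)
    (hφ : ∀ x y x' y', |φ x y - φ x' y'| ≤ ‖y - y'‖ + ρ * ‖x - x'‖)
    (hπ : (π.prod ν).map (fun p => A p.1 + p.2) = π) (hπi : Integrable (fun x => ‖x‖) π) (m : ℕ)
    (x : E) :
    |valueFun ν A φ m x - m * ∫ p, φ p.1 (A p.1 + p.2) ∂(π.prod ν)| ≤
      K * (‖x‖ + ∫ x, ‖x‖ ∂π) := by
  rw [← integral_valueFun_of_stationary hν hK hρK hA hφ hπ hπi m]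
  exact abs_sub_integral_le hπi hK (abs_valueFun_sub_le hν hK hρK hA hφ m) x

end Stationary

/-! ### The autoregression: a version satisfying the recursion everywhere, and its filtration. -/

section VectorAutoregression

variable {Ω : Type*} {M : ℕ} {A : Matrix (Fin M) (Fin M) ℝ}
  {X ξ : ℕ → Ω → EuclideanSpace ℝ (Fin M)}

/-- The chain `y_{k+1} = A y_k + ξ_{k+2}`, `y_0 = X_1`, with the recursion holding everywhere. -/
noncomputable def chain (A : Matrix (Fin M) (Fin M) ℝ) (X ξ : ℕ → Ω → EuclideanSpace ℝ (Fin M)) :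
    ℕ → Ω → EuclideanSpace ℝ (Fin M)
  | 0, ω => X 1 ω
  | k + 1, ω => Matrix.toEuclideanCLM (n := Fin M) (𝕜 := ℝ) A (chain A X ξ k ω) + ξ (k + 2) ω

/-- The initial value and the first `k` noise variables. -/
def history (X ξ : ℕ → Ω → EuclideanSpace ℝ (Fin M)) (k : ℕ) (ω : Ω) :
    EuclideanSpace ℝ (Fin M) × (Finset.range k → EuclideanSpace ℝ (Fin M)) :=
  (X 1 ω, fun i => ξ (i + 2) ω)

theorem comap_history_mono :
    Monotone fun k => MeasurableSpace.comap (history X ξ k) inferInstance := by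
  intro j k hjk
  have : history X ξ j = (fun p : EuclideanSpace ℝ (Fin M) ×
      (Finset.range k → EuclideanSpace ℝ (Fin M)) =>
        (p.1, fun i : Finset.range j => p.2 ⟨i.1, Finset.range_mono hjk i.2⟩)) ∘
      history X ξ k := rfl
  dsimp only
  rw [this, ← MeasurableSpace.comap_comp]
  refine MeasurableSpace.comap_mono (Measurable.comap_le ?_)
  exact measurable_fst.prodMk (measurable_pi_lambda _ fun i =>
    (measurable_pi_apply _).comp measurable_snd)

theorem measurable_chain_comap_history (k : ℕ) :
    Measurable[MeasurableSpace.comap (history X ξ k) inferInstance] (chain A X ξ k) := by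
  induction k with
  | zero => exact measurable_fst.comp (comap_measurable (history X ξ 0))
  | succ k ih =>
    have h1 : Measurable[MeasurableSpace.comap (history X ξ (k + 1)) inferInstance]
        (chain A X ξ k) := ih.mono (comap_history_mono (Nat.le_succ k)) le_rfl
    have h2 : Measurable[MeasurableSpace.comap (history X ξ (k + 1)) inferInstance]
        (ξ (k + 2)) :=
      (measurable_pi_apply (⟨k, Finset.self_mem_range_succ k⟩ : Finset.range (k + 1))).comp
        (measurable_snd.comp (comap_measurable (history X ξ (k + 1))))
    exact ((Matrix.toEuclideanCLM (n := Fin M) (𝕜 := ℝ) A).continuous.measurable.comp h1).add h2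

variable [MeasurableSpace Ω] {μ : Measure Ω}

/-- The recursion for `X` holds only almost surely, whereas adaptedness needs it pointwise; `chain`
at time `k` stands for the process at time `k + 1`. -/
theorem IsStationaryVAR.chain_ae_eq (h : IsStationaryVAR μ A X ξ) (k : ℕ) :
    ∀ᵐ ω ∂μ, X (k + 1) ω = chain A X ξ k ω := by
  induction k with
  | zero => exact ae_of_all _ fun ω => rfl
  | succ k ih =>
    filter_upwards [ih, h.recursion (k + 1 + 1) (by omega)] with ω h1 h2
    rw [h2, Nat.add_sub_cancel, h1]
    rfl

theorem IsStationaryVAR.measurable_history (h : IsStationaryVAR μ A X ξ) (k : ℕ) :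
    Measurable (history X ξ k) :=
  (h.measurable_process 1 le_rfl).prodMk
    (measurable_pi_lambda _ fun i => h.measurable_noise _ (by omega))

/-- `X 1` is independent of the whole noise sequence, and the past noise of the next one; the two
product laws combine by associativity of products of measures. -/
theorem IsStationaryVAR.indep_history [IsProbabilityMeasure μ]
    (h : IsStationaryVAR μ A X ξ) (k : ℕ) :
    Indep (MeasurableSpace.comap (history X ξ k) inferInstance)
      (MeasurableSpace.comap (ξ (k + 2)) inferInstance) μ := by
  have hξ : ∀ k, Measurable (ξ (k + 2)) := fun k => h.measurable_noise _ (by omega)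
  set P : Ω → (Finset.range k → EuclideanSpace ℝ (Fin M)) := fun ω i => ξ (i + 2) ω with hP
  have hPm : Measurable P := measurable_pi_lambda _ fun i => hξ i
  have hX := h.measurable_process 1 le_rfl
  have h1 : IndepFun P (ξ (k + 2)) μ :=
    (h.noise_indep.indepFun_finset (Finset.range k) {k} (by simp) hξ).comp measurable_id
      (measurable_pi_apply (⟨k, Finset.mem_singleton_self k⟩ : ({k} : Finset ℕ)))
  have h2 : IndepFun (X 1) (fun ω => (P ω, ξ (k + 2) ω)) μ :=
    h.init_indep.comp measurable_id (ψ := fun q : ℕ → EuclideanSpace ℝ (Fin M) =>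
      ((fun i : Finset.range k => q i), q k)) (by fun_prop)
  have h3 : IndepFun (X 1) P μ := h2.comp measurable_id measurable_fst
  have h4 : IndepFun (history X ξ k) (ξ (k + 2)) μ := by
    rw [indepFun_iff_map_prod_eq_prod_map_map (h.measurable_history k).aemeasurable
      (hξ k).aemeasurable]
    have e1 := h1.map_prod_eq_prod_map_map hPm.aemeasurable (hξ k).aemeasurable
    have e2 := h2.map_prod_eq_prod_map_map hX.aemeasurable (hPm.prodMk (hξ k)).aemeasurable
    have e3 : μ.map (history X ξ k) = (μ.map (X 1)).prod (μ.map P) :=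
      h3.map_prod_eq_prod_map_map hX.aemeasurable hPm.aemeasurable
    have := Measure.isProbabilityMeasure_map (μ := μ) hX.aemeasurable
    have := Measure.isProbabilityMeasure_map (μ := μ) hPm.aemeasurable
    have := Measure.isProbabilityMeasure_map (μ := μ) (hξ k).aemeasurable
    rw [e3, ← (measurePreserving_prodAssoc (μ.map (X 1)) (μ.map P)
      (μ.map (ξ (k + 2)))).symm.map_eq, ← e1, ← e2,
      Measure.map_map (MeasurableEquiv.measurable _) (hX.prodMk (hPm.prodMk (hξ k)))]
    rfl
  exact (IndepFun_iff_Indep _ _ _).1 h4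

theorem IsStationaryVAR.measurable_chain (h : IsStationaryVAR μ A X ξ) (k : ℕ) :
    Measurable (chain A X ξ k) :=
  (measurable_chain_comap_history k).mono (h.measurable_history k).comap_le le_rfl

theorem IsStationaryVAR.map_noise (h : IsStationaryVAR μ A X ξ) (k : ℕ) :
    μ.map (ξ (k + 2)) = μ.map (ξ 2) := (h.noise_identDistrib _ (by omega)).map_eq

theorem IsStationaryVAR.indepFun_chain [IsProbabilityMeasure μ]
    (h : IsStationaryVAR μ A X ξ) (k : ℕ) :
    IndepFun (chain A X ξ k) (ξ (k + 2)) μ := by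
  rw [IndepFun_iff_Indep]
  exact indep_of_indep_of_le_left (h.indep_history k) (measurable_chain_comap_history k).comap_le

theorem IsStationaryVAR.map_chain [IsProbabilityMeasure μ]
    (h : IsStationaryVAR μ A X ξ) (k : ℕ) :
    μ.map (chain A X ξ k) = μ.map (X 1) := by
  induction k with
  | zero => rfl
  | succ k ih =>
    have hz : Measurable (ξ (k + 2)) := h.measurable_noise _ (by omega)
    have hl := (h.indepFun_chain k).map_prod_eq_prod_map_map (h.measurable_chain k).aemeasurable
      hz.aemeasurable
    have hst := h.init_law
    rw [IsStationaryLaw, ← h.map_noise k, ← ih, ← hl, ih, Measure.map_map _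
      ((h.measurable_chain k).prodMk hz)] at hst
    · exact hst
    · exact ((Matrix.toEuclideanCLM (n := Fin M) (𝕜 := ℝ) A).continuous.measurable.comp
        measurable_fst).add measurable_snd

/-- The joint law of `(X_{t-1}, ξ_t)`. -/
theorem IsStationaryVAR.map_chain_noise [IsProbabilityMeasure μ]
    (h : IsStationaryVAR μ A X ξ) (k : ℕ) :
    μ.map (fun ω => (chain A X ξ k ω, ξ (k + 2) ω)) = (μ.map (X 1)).prod (μ.map (ξ 2)) := by
  have hz : Measurable (ξ (k + 2)) := h.measurable_noise _ (by omega)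
  rw [(h.indepFun_chain k).map_prod_eq_prod_map_map (h.measurable_chain k).aemeasurable
      hz.aemeasurable, h.map_chain, h.map_noise]

end VectorAutoregression

/-! ### Exponential moment of the Euclidean norm of the noise. -/

/-- `y ↦ cosh √y` is a power series with nonnegative coefficients, so Jensen applies term by term to
the mean of the `(x_j / c)²`. The function `exp √y` is not convex near 0, hence the detour through
`cosh`. -/
theorem cosh_norm_div_le {M : ℕ} (hM : 0 < M) {c : ℝ} (hc : 0 < c)
    (x : EuclideanSpace ℝ (Fin M)) :
    Real.cosh (‖x‖ / (c * √M)) ≤ ∑ j, (1 / (M : ℝ)) * Real.cosh (x j / c) := by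
  have hM' : (0 : ℝ) < M := by exact_mod_cast hM
  refine hasSum_le (fun k => ?_) (Real.hasSum_cosh _)
    (hasSum_sum fun j (_ : j ∈ Finset.univ) => (Real.hasSum_cosh (x j / c)).mul_left (1 / (M : ℝ)))
  have h1 : (‖x‖ / (c * √M)) ^ 2 = ∑ j, (1 / (M : ℝ)) * (x j / c) ^ 2 := by
    rw [div_pow, EuclideanSpace.real_norm_sq_eq, mul_pow, Real.sq_sqrt hM'.le, Finset.sum_div]
    refine Finset.sum_congr rfl fun j _ => ?_
    field_simp
  have h2 : (‖x‖ / (c * √M)) ^ (2 * k) ≤ ∑ j, (1 / (M : ℝ)) * (x j / c) ^ (2 * k) := by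
    simp only [pow_mul, h1]
    exact Real.pow_arith_mean_le_arith_mean_pow Finset.univ (fun _ => 1 / (M : ℝ))
      (fun j => (x j / c) ^ 2) (fun _ _ => by positivity) (by simp [hM'.ne'])
      (fun _ _ => by positivity) k
  calc _ ≤ (∑ j, (1 / (M : ℝ)) * (x j / c) ^ (2 * k)) / ((2 * k).factorial : ℝ) := by gcongr
    _ = _ := by
      rw [Finset.sum_div]
      exact Finset.sum_congr rfl fun j _ => by ring

theorem exp_norm_div_le {M : ℕ} (hM : 0 < M) {c : ℝ} (hc : 0 < c)
    (x : EuclideanSpace ℝ (Fin M)) :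
    Real.exp (‖x‖ / (c * √M)) ≤ ∑ j, (2 / (M : ℝ)) * Real.exp (|x j| / c) := by
  have h1 := cosh_norm_div_le hM hc x
  have h2 : Real.exp (‖x‖ / (c * √M)) ≤ 2 * Real.cosh (‖x‖ / (c * √M)) := by
    rw [Real.cosh_eq]; have := Real.exp_pos (-(‖x‖ / (c * √M))); linarith
  refine h2.trans ((mul_le_mul_of_nonneg_left h1 zero_le_two).trans ?_)
  rw [Finset.mul_sum]
  refine Finset.sum_le_sum fun j _ => ?_
  have h3 : Real.cosh (x j / c) ≤ Real.exp (|x j| / c) := by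
    rw [← Real.cosh_abs, abs_div, abs_of_pos hc, Real.cosh_eq]
    have : Real.exp (-(|x j| / c)) ≤ Real.exp (|x j| / c) :=
      Real.exp_le_exp.2 (by have : 0 ≤ |x j| / c := by positivity
                            linarith)
    linarith
  calc _ = 2 / (M : ℝ) * Real.cosh (x j / c) := by ring
    _ ≤ _ := by gcongr

theorem HasExpMoments.integrable_exp_norm {Ω : Type*} [MeasurableSpace Ω] {μ : Measure Ω} {M : ℕ}
    (hM : 0 < M) {ξ : Ω → EuclideanSpace ℝ (Fin M)} (hξ : Measurable ξ) {c d : ℝ} (hc : 0 < c)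
    (h : HasExpMoments μ ξ c d) :
    Integrable (fun z => Real.exp (‖z‖ / (c * √M))) (μ.map ξ) ∧
      ∫ z, Real.exp (‖z‖ / (c * √M)) ∂(μ.map ξ) ≤ 2 * d := by
  have hM' : (0 : ℝ) < M := by exact_mod_cast hM
  have hcont : Continuous fun z : EuclideanSpace ℝ (Fin M) => Real.exp (‖z‖ / (c * √M)) := by
    fun_prop
  have hsum : Integrable (fun ω => ∑ j, (2 / (M : ℝ)) * Real.exp (|ξ ω j| / c)) μ :=
    integrable_finsetSum _ fun j _ => (h j).1.const_mul _
  have hint : Integrable (fun ω => Real.exp (‖ξ ω‖ / (c * √M))) μ := by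
    refine hsum.mono' (hcont.measurable.comp hξ).aestronglyMeasurable (ae_of_all _ fun ω => ?_)
    rw [Real.norm_eq_abs, abs_of_pos (Real.exp_pos _)]
    exact exp_norm_div_le hM hc _
  refine ⟨(integrable_map_measure hcont.aestronglyMeasurable hξ.aemeasurable).2 hint, ?_⟩
  rw [integral_map hξ.aemeasurable hcont.aestronglyMeasurable]
  refine (integral_mono hint hsum fun ω => exp_norm_div_le hM hc _).trans ?_
  rw [integral_finsetSum _ fun j _ => (h j).1.const_mul _]
  calc ∑ j, ∫ ω, 2 / (M : ℝ) * Real.exp (|ξ ω j| / c) ∂μ ≤ ∑ _ : Fin M, 2 / (M : ℝ) * d := by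
        refine Finset.sum_le_sum fun j _ => ?_
        rw [integral_const_mul]
        exact mul_le_mul_of_nonneg_left (h j).2 (by positivity)
    _ = 2 * d := by simp; field_simp

/-! ### Low rank matrices: factorization, compactness and nets. -/

section LowRank

variable {M r : ℕ}

/-- The columns of `U` are an orthonormal basis of the range padded with zeros, and `V = Uᵀ Q`; its
entries are inner products of vectors of norm at most 1 and `‖Q‖`. -/
theorem exists_factorization_of_rank_le (Q : Matrix (Fin M) (Fin M) ℝ) (hQ : Q.rank ≤ r) :
    ∃ (U : Matrix (Fin M) (Fin r) ℝ) (V : Matrix (Fin r) (Fin M) ℝ), Q = U * V ∧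
      (∀ i j, |U i j| ≤ 1) ∧ ∀ i j, |V i j| ≤ schattenInf Q := by
  set T := Matrix.toEuclideanLin Q with hT
  have hk : Module.finrank ℝ (LinearMap.range T) ≤ r := by
    rwa [Matrix.rank_eq_finrank_range_toLin Q (EuclideanSpace.basisFun (Fin M) ℝ).toBasis
      (EuclideanSpace.basisFun (Fin M) ℝ).toBasis] at hQ
  set k := Module.finrank ℝ (LinearMap.range T)
  let b : OrthonormalBasis (Fin k) ℝ (LinearMap.range T) := stdOrthonormalBasis ℝ _
  let u : Fin r → EuclideanSpace ℝ (Fin M) := fun j =>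
    if h : j.1 < k then (b ⟨j.1, h⟩ : EuclideanSpace ℝ (Fin M)) else 0
  have hu : ∀ j, ‖u j‖ ≤ 1 := by
    intro j
    by_cases h : j.1 < k
    · have : ‖b ⟨j.1, h⟩‖ = 1 := b.norm_eq_one _
      simp only [u, h, dif_pos]
      exact this.le
    · simp [u, h]
  let e : Fin M → EuclideanSpace ℝ (Fin M) := fun i => EuclideanSpace.single i 1
  have hQe : ∀ i j, T (e j) i = Q i j := by
    intro i j
    simp [T, e, Matrix.toEuclideanLin, Matrix.toLpLin]
  have hsum : ∀ v : LinearMap.range T, (v : EuclideanSpace ℝ (Fin M)) =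
      ∑ j, inner ℝ (u j) (v : EuclideanSpace ℝ (Fin M)) • u j := by
    intro v
    have h1 : (v : EuclideanSpace ℝ (Fin M)) =
        ∑ j : Fin k, inner ℝ (b j : EuclideanSpace ℝ (Fin M)) (v : EuclideanSpace ℝ (Fin M)) •
          (b j : EuclideanSpace ℝ (Fin M)) := by
      conv_lhs => rw [← b.sum_repr' v]
      simp
    rw [h1]
    conv_rhs => rw [← h1]
    refine Fintype.sum_of_injective (Fin.castLE hk) (Fin.castLE_injective hk) _ _ ?_ ?_
    · intro j hj
      have : ¬ j.1 < k := fun h => hj ⟨⟨j.1, h⟩, rfl⟩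
      simp [u, this]
    · intro j
      simp [u]
  refine ⟨Matrix.of fun i j => u j i, Matrix.of fun j m => inner ℝ (u j) (T (e m)), ?_, ?_, ?_⟩
  · ext i m
    rw [← hQe, Matrix.mul_apply]
    have h1 := hsum ⟨T (e m), LinearMap.mem_range_self T _⟩
    simp only at h1
    conv_lhs => rw [h1]
    simp [mul_comm]
  · intro i j
    exact (PiLp.norm_apply_le (u j) i).trans (hu j)
  · intro j m
    have h1 : ‖T (e m)‖ ≤ schattenInf Q := by
      rw [schattenInf_eq_opNorm]
      refine ((Matrix.toEuclideanCLM (n := Fin M) (𝕜 := ℝ) Q).le_opNorm (e m)).trans_eq ?_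
      simp [e]
    change |inner ℝ (u j) (T (e m))| ≤ _
    refine (abs_real_inner_le_norm _ _).trans ?_
    calc _ ≤ 1 * schattenInf Q := by
          exact mul_le_mul (hu j) h1 (norm_nonneg _) zero_le_one
      _ = _ := one_mul _

theorem norm_toEuclideanCLM_le {a : ℝ} (ha : 0 ≤ a) {D : Matrix (Fin M) (Fin M) ℝ}
    (hD : ∀ i j, |D i j| ≤ a) : ‖Matrix.toEuclideanCLM (n := Fin M) (𝕜 := ℝ) D‖ ≤ M * a := by
  refine ContinuousLinearMap.opNorm_le_bound _ (by positivity) fun v => ?_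
  have h1 : ∀ i, (Matrix.toEuclideanCLM (n := Fin M) (𝕜 := ℝ) D v) i = ∑ j, D i j * v j :=
    fun i => rfl
  have h2 : ∀ i, (∑ j, D i j * v j) ^ 2 ≤ M * a ^ 2 * ‖v‖ ^ 2 := by
    intro i
    refine (Finset.sum_mul_sq_le_sq_mul_sq _ _ _).trans ?_
    rw [EuclideanSpace.real_norm_sq_eq]
    gcongr
    calc ∑ j, D i j ^ 2 ≤ ∑ _ : Fin M, a ^ 2 :=
          Finset.sum_le_sum fun j _ => sq_le_sq' (by linarith [neg_abs_le (D i j), hD i j])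
            ((le_abs_self _).trans (hD i j))
      _ = _ := by simp
  have h3 : ‖Matrix.toEuclideanCLM (n := Fin M) (𝕜 := ℝ) D v‖ ^ 2 ≤ (M * a * ‖v‖) ^ 2 := by
    rw [EuclideanSpace.real_norm_sq_eq]
    simp only [h1]
    calc _ ≤ ∑ _ : Fin M, M * a ^ 2 * ‖v‖ ^ 2 := Finset.sum_le_sum fun i _ => h2 i
      _ = _ := by simp; ring
  exact (sq_le_sq₀ (norm_nonneg _) (by positivity)).1 h3

theorem zero_mem_lowRankBall {ρ : ℝ} (hρ : 0 ≤ ρ) : (0 : Matrix (Fin M) (Fin M) ℝ) ∈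
    lowRankBall M ρ r := by
  refine ⟨by simp, ?_⟩
  rw [schattenInf_eq_opNorm]
  simpa using hρ

theorem continuous_toEuclideanCLM :
    Continuous (Matrix.toEuclideanCLM (n := Fin M) (𝕜 := ℝ)) :=
  LinearMap.continuous_of_finiteDimensional
    (Matrix.toEuclideanCLM (n := Fin M) (𝕜 := ℝ)).toAlgEquiv.toLinearMap

/-- The rank constraint is handled as the image of two compact boxes under multiplication, cut by
the closed norm ball; `ρ ≤ 1` keeps `V` in its box. -/
theorem isCompact_lowRankBall {ρ : ℝ} (hρ : ρ ≤ 1) : IsCompact (lowRankBall M ρ r) := by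
  have hbox : ∀ a b : ℕ, IsCompact {U : Matrix (Fin a) (Fin b) ℝ | ∀ i j, |U i j| ≤ 1} := by
    intro a b
    have : {U : Matrix (Fin a) (Fin b) ℝ | ∀ i j, |U i j| ≤ 1} =
        Set.pi Set.univ fun _ => Set.pi Set.univ fun _ => Set.Icc (-1) 1 := by
      ext U
      simp only [Set.mem_ofPred_eq, abs_le]
      exact ⟨fun h i _ j _ => h i j, fun h i j => h i trivial j trivial⟩
    rw [this]
    exact isCompact_univ_pi fun _ => isCompact_univ_pi fun _ => isCompact_Icc
  have himg : IsCompact ((fun p : Matrix (Fin M) (Fin r) ℝ × Matrix (Fin r) (Fin M) ℝ =>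
      p.1 * p.2) '' ({U | ∀ i j, |U i j| ≤ 1} ×ˢ {V | ∀ i j, |V i j| ≤ 1})) :=
    ((hbox M r).prod (hbox r M)).image (by fun_prop)
  have hcl : IsClosed {Q : Matrix (Fin M) (Fin M) ℝ | schattenInf Q ≤ ρ} := by
    simp only [schattenInf_eq_opNorm]
    exact isClosed_le continuous_toEuclideanCLM.norm continuous_const
  convert himg.inter_right hcl using 1
  ext Q
  constructor
  · rintro ⟨h1, h2⟩
    obtain ⟨U, V, h, hU, hV⟩ := exists_factorization_of_rank_le Q h1
    exact ⟨⟨(U, V), ⟨hU, fun i j => (hV i j).trans (h2.trans hρ)⟩, h.symm⟩, h2⟩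
  · rintro ⟨⟨⟨U, V⟩, -, rfl⟩, h2⟩
    exact ⟨(Matrix.rank_mul_le_left U V).trans (Matrix.rank_le_width U), h2⟩

theorem abs_sub_le_of_floor_eq {x y : ℝ} {q : ℕ} (hq : 0 < q) (hx : |x| ≤ 1) (hy : |y| ≤ 1)
    (h : ⌊(x + 1) * q⌋₊ = ⌊(y + 1) * q⌋₊) : |x - y| ≤ 1 / q := by
  have hq' : (0 : ℝ) < q := by exact_mod_cast hq
  have hx0 : 0 ≤ (x + 1) * q := mul_nonneg (by linarith [neg_abs_le x]) hq'.le
  have hy0 : 0 ≤ (y + 1) * q := mul_nonneg (by linarith [neg_abs_le y]) hq'.le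
  have h1 := Nat.floor_le hx0
  have h2 := Nat.lt_floor_add_one ((x + 1) * q)
  have h3 := Nat.floor_le hy0
  have h4 := Nat.lt_floor_add_one ((y + 1) * q)
  rw [h] at h1 h2
  have h5 : |x - y| * q = |(x - y) * q| := by rw [abs_mul, abs_of_pos hq']
  rw [le_div_iff₀ hq', h5, abs_le]
  constructor <;> nlinarith

/-- The entries of both factors are rounded to a grid of step `1/q`, and one matrix of the ball is
chosen per nonempty cell. Net points must lie in the ball itself, since the deviation bound requires
norm at most `ρ`. -/
theorem exists_net_lowRankBall {ρ : ℝ} (hρ0 : 0 ≤ ρ) (hρ : ρ ≤ 1) {q : ℕ} (hq : 0 < q) :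
    ∃ S : Finset (Matrix (Fin M) (Fin M) ℝ), (∀ Q ∈ S, Q ∈ lowRankBall M ρ r) ∧
      S.card ≤ (2 * q + 1) ^ (2 * (M * r)) ∧
      ∀ Q ∈ lowRankBall M ρ r, ∃ Q' ∈ S,
        ‖Matrix.toEuclideanCLM (n := Fin M) (𝕜 := ℝ) (Q - Q')‖ ≤ M * (2 * r / q) := by
  classical
  have hq' : (0 : ℝ) < q := by exact_mod_cast hq
  have hcell : ∀ x : ℝ, |x| ≤ 1 → ⌊(x + 1) * q⌋₊ < 2 * q + 1 := by
    intro x hx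
    rw [Nat.lt_succ_iff]
    refine Nat.floor_le_of_le ?_
    push_cast
    have := (le_abs_self x).trans hx
    nlinarith
  let ι := (Fin M → Fin r → Fin (2 * q + 1)) × (Fin r → Fin M → Fin (2 * q + 1))
  let P : ι → Matrix (Fin M) (Fin M) ℝ → Prop := fun p Q => Q ∈ lowRankBall M ρ r ∧
    ∃ (U : Matrix (Fin M) (Fin r) ℝ) (V : Matrix (Fin r) (Fin M) ℝ), Q = U * V ∧
      (∀ i j, |U i j| ≤ 1) ∧ (∀ i j, |V i j| ≤ 1) ∧
      (∀ i j, ⌊(U i j + 1) * q⌋₊ = (p.1 i j : ℕ)) ∧ ∀ i j, ⌊(V i j + 1) * q⌋₊ = (p.2 i j : ℕ)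
  let rep : ι → Matrix (Fin M) (Fin M) ℝ := fun p =>
    -- Empty cells are sent to 0, which belongs to the ball.
    if h : ∃ Q, P p Q then h.choose else 0
  refine ⟨Finset.univ.image rep, ?_, ?_, ?_⟩
  · intro Q hQ
    obtain ⟨p, -, rfl⟩ := Finset.mem_image.1 hQ
    by_cases h : ∃ Q, P p Q
    · simp only [rep, h, dif_pos]; exact h.choose_spec.1
    · simp only [rep, h, dif_neg, not_false_iff]; exact zero_mem_lowRankBall hρ0
  · refine Finset.card_image_le.trans (le_of_eq ?_)
    simp only [ι, Finset.card_univ, Fintype.card_prod, Fintype.card_fun, Fintype.card_fin]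
    rw [← pow_mul, ← pow_mul, ← pow_add]
    congr 1; ring
  · intro Q hQ
    obtain ⟨U, V, h, hU, hV⟩ := exists_factorization_of_rank_le Q hQ.1
    have hV' : ∀ i j, |V i j| ≤ 1 := fun i j => (hV i j).trans (hQ.2.trans hρ)
    let p : ι := (fun i j => ⟨_, hcell _ (hU i j)⟩, fun i j => ⟨_, hcell _ (hV' i j)⟩)
    have hp : ∃ Q, P p Q := ⟨Q, hQ, U, V, h, hU, hV', fun _ _ => rfl, fun _ _ => rfl⟩
    refine ⟨rep p, Finset.mem_image_of_mem _ (Finset.mem_univ _), ?_⟩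
    have hrep : rep p = hp.choose := by simp only [rep, hp, dif_pos]
    obtain ⟨-, U', V', h', hU', hV1', hfU, hfV⟩ := hp.choose_spec
    rw [hrep, h']
    refine norm_toEuclideanCLM_le (by positivity) fun i j => ?_
    rw [h, Matrix.sub_apply, Matrix.mul_apply, Matrix.mul_apply, ← Finset.sum_sub_distrib]
    refine (Finset.abs_sum_le_sum_abs _ _).trans ?_
    calc ∑ l, |U i l * V l j - U' i l * V' l j| ≤ ∑ _ : Fin r, 2 / (q : ℝ) := by
          refine Finset.sum_le_sum fun l _ => ?_
          have e1 := abs_sub_le_of_floor_eq hq (hU i l) (hU' i l) (hfU i l).symm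
          have e2 := abs_sub_le_of_floor_eq hq (hV' l j) (hV1' l j) (hfV l j).symm
          calc |U i l * V l j - U' i l * V' l j|
              = |U i l * (V l j - V' l j) + (U i l - U' i l) * V' l j| := by congr 1; ring
            _ ≤ |U i l| * |V l j - V' l j| + |U i l - U' i l| * |V' l j| := by
                rw [← abs_mul, ← abs_mul]; exact abs_add_le _ _
            _ ≤ 1 * (1 / q) + 1 / q * 1 := by
                gcongr
                · exact hU i l
                · exact hV1' l j
            _ = _ := by ring
      _ = _ := by simp; ring

end LowRank

/-! ### Sample size condition and Chernoff parameters. -/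

theorem two_le_of_sample_size {κ : ℝ} (hκ : 0 < κ) {M n r : ℕ} (hr : 1 ≤ r) (hM : 1 ≤ M)
    (hn : (n : ℝ) ≥ 1 + κ * M * r * Real.log (9 * r * n)) : 2 ≤ n := by
  have hr' : (1 : ℝ) ≤ r := by exact_mod_cast hr
  have hM' : (1 : ℝ) ≤ M := by exact_mod_cast hM
  by_contra! h
  interval_cases n
  -- Since `Real.log 0 = 0`, the condition at `n = 0` reads `0 ≥ 1`.
  · norm_num at hn
  · have : 0 < Real.log (9 * r * (1 : ℕ)) := Real.log_pos (by push_cast; linarith)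
    have : 0 < κ * M * r * Real.log (9 * r * (1 : ℕ)) := by positivity
    push_cast at *
    linarith

/-- Choice of the parameters of the Chernoff bound, after a union bound over a net with
`(2 M r n + 1) ^ (2 M r)` elements. -/
theorem exists_deviation_parameters {κ η D : ℝ} (hκ : 0 < κ) (hη : 0 < η) (hD : 0 ≤ D) :
    ∃ C : ℝ, 0 < C ∧ ∀ M n r : ℕ, 1 ≤ r → 1 ≤ M →
      (n : ℝ) ≥ 1 + κ * M * r * Real.log (9 * r * n) →
      ∃ t u : ℝ, 0 ≤ t ∧ t ≤ 1 ∧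
        ((2 * (M * r * n) + 1) ^ (2 * (M * r)) : ℕ) *
          (2 * Real.exp (((n : ℝ) - 1) * (t ^ 2 * D) - t * u)) ≤ η ∧
        u / ((n : ℝ) - 1) ≤ C * √(M * r * (Real.log n / n)) := by
  set a := min κ 1 with ha
  have ha0 : 0 < a := lt_min hκ one_pos
  -- With `b = M r log n`, the first summand times `b` dominates `log (2/η)` because `b ≥ 1/2`; the
  -- second dominates the log-cardinality of the net.
  set C₁ := 2 * |Real.log (2 / η)| + 2 * (2 * |Real.log (3 / κ)| + 2) with hC₁
  have hC₁0 : 0 < C₁ := by positivity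
  refine ⟨2 * (C₁ / √a + D * √a), by positivity, fun M n r hr hM hn => ?_⟩
  have hn2 := two_le_of_sample_size hκ hr hM hn
  have hr' : (1 : ℝ) ≤ r := by exact_mod_cast hr
  have hM' : (1 : ℝ) ≤ M := by exact_mod_cast hM
  have hn' : (2 : ℝ) ≤ n := by exact_mod_cast hn2
  have hMr : (1 : ℝ) ≤ M * r := one_le_mul_of_one_le_of_one_le hM' hr'
  have hlogn : 1 / 2 ≤ Real.log n := by
    have := Real.log_two_gt_d9
    have := Real.log_le_log two_pos hn'
    linarith
  set N := (n : ℝ) - 1 with hN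
  have hN1 : 1 ≤ N := by linarith
  set b := M * r * Real.log n with hb
  have hbn : Real.log n ≤ b := le_mul_of_one_le_left (by linarith) hMr
  have hb0 : 0 < b := by linarith
  have h9 : (n : ℝ) ≤ 9 * r * n := by nlinarith
  have hlog9 : Real.log n ≤ Real.log (9 * r * n) := Real.log_le_log (by linarith) h9
  have hlog9' : 1 ≤ Real.log (9 * r * n) := by
    rw [Real.le_log_iff_exp_le (by linarith)]
    have := Real.exp_one_lt_d9
    nlinarith
  have hκb : κ * b ≤ N := by
    have : κ * b ≤ κ * M * r * Real.log (9 * r * n) := by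
      calc κ * b = κ * (M * r) * Real.log n := by rw [hb]; ring
        _ ≤ κ * (M * r) * Real.log (9 * r * n) := by gcongr
        _ = _ := by ring
    linarith
  -- This makes the grid size `2Mrn + 1` polynomial in `n`, so its logarithm is `O(log n)` with no
  -- dependence on `M` or `r`.
  have hκMr : κ * (M * r) ≤ n := by
    have : κ * (M * r) * 1 ≤ κ * (M * r) * Real.log (9 * r * n) := by gcongr
    linarith
  have hab : a * b ≤ N := (mul_le_mul_of_nonneg_right (min_le_left _ _) hb0.le).trans hκb
  -- Up to constants this balances `N t² D` with `C₁ b`; the sample size condition is what gives `t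
  -- ≤ 1`. Below, `u` is solved so that the exponent equals `-C₁ b`.
  set t := √a * √(b / N) with ht
  have ht2 : t ^ 2 = a * (b / N) := by
    rw [ht, mul_pow, Real.sq_sqrt ha0.le, Real.sq_sqrt (by positivity)]
  have ht0 : 0 < t := by positivity
  have ht1 : t ≤ 1 := by
    rw [← sq_le_one_iff₀ ht0.le, ht2, ← mul_div_assoc, div_le_one (by linarith)]
    exact hab
  refine ⟨t, (C₁ * b + N * (t ^ 2 * D)) / t, ht0.le, ht1, ?_, ?_⟩
  · have e1 : N * (t ^ 2 * D) - t * ((C₁ * b + N * (t ^ 2 * D)) / t) = -(C₁ * b) := by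
      field_simp; ring
    rw [e1]
    set q : ℝ := 2 * (M * r * n) + 1 with hq
    have hMrn : (1 : ℝ) ≤ M * r * n := one_le_mul_of_one_le_of_one_le hMr (by linarith)
    have hq0 : 0 < q := by positivity
    have hq1 : q ≤ 3 / κ * n ^ 2 := by
      calc q ≤ 3 * (M * r * n) := by linarith
        _ = 3 / κ * (κ * (M * r) * n) := by field_simp
        _ ≤ 3 / κ * (n * n) := by gcongr
        _ = _ := by ring
    have hlogq : Real.log q ≤ (2 * |Real.log (3 / κ)| + 2) * Real.log n := by
      calc Real.log q ≤ Real.log (3 / κ * n ^ 2) := Real.log_le_log hq0 hq1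
        _ = Real.log (3 / κ) + 2 * Real.log n := by
          rw [Real.log_mul (by positivity) (by positivity), Real.log_pow]; norm_num
        _ ≤ |Real.log (3 / κ)| * (2 * Real.log n) + 2 * Real.log n := by
          have := le_abs_self (Real.log (3 / κ))
          have : |Real.log (3 / κ)| * 1 ≤ |Real.log (3 / κ)| * (2 * Real.log n) := by
            gcongr; linarith
          linarith
        _ = _ := by ring
    have hlogη : Real.log (2 / η) ≤ 2 * |Real.log (2 / η)| * b := by
      have := le_abs_self (Real.log (2 / η))
      have : |Real.log (2 / η)| * 1 ≤ |Real.log (2 / η)| * (2 * b) := by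
        gcongr; linarith
      linarith
    have hcast : (((2 * (M * r * n) + 1) ^ (2 * (M * r)) : ℕ) : ℝ) =
        Real.exp (2 * (M * r) * Real.log q) := by
      rw [show (2 * ((M : ℝ) * r)) = ((2 * (M * r) : ℕ) : ℝ) by push_cast; ring,
        Real.exp_nat_mul, Real.exp_log hq0, hq]
      push_cast
      ring
    have h2 : (2 : ℝ) = η * Real.exp (Real.log (2 / η)) := by
      rw [Real.exp_log (by positivity)]; field_simp
    calc _ = η * Real.exp (2 * (M * r) * Real.log q + Real.log (2 / η) + -(C₁ * b)) := by
          rw [hcast, Real.exp_add, Real.exp_add, Real.exp_log (by positivity : 0 < 2 / η)]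
          field_simp
      _ ≤ η * Real.exp 0 := by
          gcongr
          have : 2 * (M * r) * Real.log q ≤
              2 * (M * r) * ((2 * |Real.log (3 / κ)| + 2) * Real.log n) := by gcongr
          have e : 2 * (M * r) * ((2 * |Real.log (3 / κ)| + 2) * Real.log n) =
              2 * (2 * |Real.log (3 / κ)| + 2) * b := by rw [hb]; ring
          rw [hC₁]
          linarith
      _ = η := by simp
  · have hsq : √(b / N) ≤ 2 * √(M * r * (Real.log n / n)) := by
      rw [show (2 : ℝ) = √4 by rw [show (4 : ℝ) = 2 ^ 2 by norm_num]; simp,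
        ← Real.sqrt_mul (by norm_num)]
      refine Real.sqrt_le_sqrt ?_
      have e : 4 * (M * r * (Real.log n / n)) = b * (4 / n) := by rw [hb]; field_simp
      have e2 : 1 / N ≤ 4 / n := by
        rw [div_le_div_iff₀ (by linarith) (by linarith)]; linarith
      rw [e, div_eq_mul_one_div]
      gcongr
    have e : (C₁ * b + N * (t ^ 2 * D)) / t / N = (C₁ / √a + D * √a) * √(b / N) := by
      have h1 : b / N = √(b / N) ^ 2 := (Real.sq_sqrt (by positivity)).symm
      have h2 : b = N * √(b / N) ^ 2 := by rw [← h1]; field_simp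
      have h3 : a = √a ^ 2 := (Real.sq_sqrt ha0.le).symm
      have hx : 0 < √(b / N) := by positivity
      have hy : 0 < √a := by positivity
      rw [ht]
      generalize √(b / N) = x at *
      generalize √a = y at *
      rw [h2]
      field_simp
    rw [e]
    calc _ ≤ (C₁ / √a + D * √a) * (2 * √(M * r * (Real.log n / n))) := by gcongr
      _ = _ := by ring

theorem one_div_le_sqrt_log_div {M n r : ℕ} (hr : 1 ≤ r) (hM : 1 ≤ M) (hn : 2 ≤ n) :
    1 / (n : ℝ) ≤ 2 * √(M * r * (Real.log n / n)) := by
  have hr' : (1 : ℝ) ≤ r := by exact_mod_cast hr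
  have hM' : (1 : ℝ) ≤ M := by exact_mod_cast hM
  have hn' : (2 : ℝ) ≤ n := by exact_mod_cast hn
  have hMr : (1 : ℝ) ≤ M * r := one_le_mul_of_one_le_of_one_le hM' hr'
  have hlogn : 1 / 2 ≤ Real.log n := by
    have := Real.log_two_gt_d9
    have := Real.log_le_log two_pos hn'
    linarith
  rw [show (2 : ℝ) = √4 by rw [show (4 : ℝ) = 2 ^ 2 by norm_num]; simp,
    ← Real.sqrt_mul (by norm_num)]
  refine Real.le_sqrt_of_sq_le ?_
  have h1 : (1 : ℝ) ≤ 4 * (M * r * Real.log n) := by nlinarith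
  calc (1 / (n : ℝ)) ^ 2 = 1 / n * (1 / n) := by ring
    _ ≤ 1 / n * 1 := by
      gcongr
      rw [div_le_one (by linarith)]; linarith
    _ ≤ 1 / n * (4 * (M * r * Real.log n)) := by gcongr
    _ = _ := by ring

/-! ### Empirical and population risk; deviations for one matrix, then uniformly. -/

section Risk

variable {Ω : Type*} {M : ℕ} {A Q : Matrix (Fin M) (Fin M) ℝ}
  {X ξ : ℕ → Ω → EuclideanSpace ℝ (Fin M)} {ℓ : EuclideanSpace ℝ (Fin M) → ℝ} {L : ℝ≥0} {ρ : ℝ}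

theorem abs_sub_le_norm_of_lipschitz (hL : L ≤ 1) (hℓ : LipschitzWith L ℓ)
    (x y : EuclideanSpace ℝ (Fin M)) : |ℓ x - ℓ y| ≤ ‖x - y‖ := by
  have h := hℓ.dist_le_mul x y
  rw [Real.dist_eq, dist_eq_norm] at h
  exact h.trans (mul_le_of_le_one_left (norm_nonneg _) (by exact_mod_cast hL))

theorem abs_predCost_sub_le (hL : L ≤ 1) (hℓ : LipschitzWith L ℓ)
    {T : EuclideanSpace ℝ (Fin M) →L[ℝ] EuclideanSpace ℝ (Fin M)} (hT : ‖T‖ ≤ ρ)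
    (x y x' y' : EuclideanSpace ℝ (Fin M)) :
    |ℓ (y - T x) - ℓ (y' - T x')| ≤ ‖y - y'‖ + ρ * ‖x - x'‖ := by
  refine (abs_sub_le_norm_of_lipschitz hL hℓ _ _).trans ?_
  rw [show y - T x - (y' - T x') = (y - y') - T (x - x') by rw [map_sub]; abel]
  exact (norm_sub_le _ _).trans (by gcongr; exact T.le_of_opNorm_le hT _)

theorem abs_predLoss_sub_le (hL : L ≤ 1) (hℓ : LipschitzWith L ℓ) (t : ℕ)
    (Q Q' : Matrix (Fin M) (Fin M) ℝ) (ω : Ω) :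
    |predLoss ℓ X t Q ω - predLoss ℓ X t Q' ω| ≤
      ‖Matrix.toEuclideanCLM (n := Fin M) (𝕜 := ℝ) (Q - Q')‖ * ‖X (t - 1) ω‖ := by
  refine (abs_sub_le_norm_of_lipschitz hL hℓ _ _).trans ?_
  rw [sub_sub_sub_cancel_left, ← norm_neg, neg_sub]
  have : Matrix.toEuclideanLin Q (X (t - 1) ω) - Matrix.toEuclideanLin Q' (X (t - 1) ω) =
      Matrix.toEuclideanCLM (n := Fin M) (𝕜 := ℝ) (Q - Q') (X (t - 1) ω) := by
    rw [map_sub]; rfl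
  rw [this]
  exact ContinuousLinearMap.le_opNorm _ _

theorem abs_empError_sub_le (hL : L ≤ 1) (hℓ : LipschitzWith L ℓ) {n : ℕ} (hn : 2 ≤ n)
    (Q Q' : Matrix (Fin M) (Fin M) ℝ) (ω : Ω) :
    |empError ℓ X n Q ω - empError ℓ X n Q' ω| ≤
      ‖Matrix.toEuclideanCLM (n := Fin M) (𝕜 := ℝ) (Q - Q')‖ *
        (1 / ((n : ℝ) - 1) * ∑ i ∈ Finset.Icc 2 n, ‖X (i - 1) ω‖) := by
  have hn' : (2 : ℝ) ≤ n := by exact_mod_cast hn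
  have hN : 0 ≤ 1 / ((n : ℝ) - 1) := one_div_nonneg.2 (by linarith)
  rw [empError, empError, ← mul_sub, ← Finset.sum_sub_distrib, abs_mul, abs_of_nonneg hN,
    mul_left_comm, Finset.mul_sum]
  gcongr
  exact (Finset.abs_sum_le_sum_abs _ _).trans
    (Finset.sum_le_sum fun i _ => abs_predLoss_sub_le hL hℓ i Q Q' ω)

variable [MeasurableSpace Ω] {μ : Measure Ω}

theorem sum_Icc_two_eq_sum_range (f : ℕ → ℝ) (n : ℕ) :
    ∑ i ∈ Finset.Icc 2 n, f i = ∑ k ∈ Finset.range (n - 1), f (k + 2) := by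
  rw [← Finset.Ico_add_one_right_eq_Icc, Finset.sum_Ico_eq_sum_range,
    show n + 1 - 2 = n - 1 by omega]
  exact Finset.sum_congr rfl fun k _ => by rw [add_comm]

/-- The risk of the linear predictor `Q`, as a function of the laws of `X_{t-1}` and `ξ_t`. -/
noncomputable def popRisk (ν π : Measure (EuclideanSpace ℝ (Fin M)))
    (A : Matrix (Fin M) (Fin M) ℝ) (ℓ : EuclideanSpace ℝ (Fin M) → ℝ)
    (Q : Matrix (Fin M) (Fin M) ℝ) : ℝ :=
  ∫ p, ℓ ((Matrix.toEuclideanCLM (n := Fin M) (𝕜 := ℝ) A p.1 + p.2) -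
    Matrix.toEuclideanCLM (n := Fin M) (𝕜 := ℝ) Q p.1) ∂(π.prod ν)

theorem IsStationaryVAR.predLoss_ae_eq (h : IsStationaryVAR μ A X ξ) (k : ℕ) :
    ∀ᵐ ω ∂μ, predLoss ℓ X (k + 2) Q ω = ℓ (chain A X ξ (k + 1) ω -
      Matrix.toEuclideanCLM (n := Fin M) (𝕜 := ℝ) Q (chain A X ξ k ω)) := by
  filter_upwards [h.chain_ae_eq k, h.chain_ae_eq (k + 1)] with ω h1 h2
  rw [← h1, ← h2]
  rfl

theorem IsStationaryVAR.measurable_empError (h : IsStationaryVAR μ A X ξ)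
    (hℓ : LipschitzWith L ℓ) (n : ℕ) (Q : Matrix (Fin M) (Fin M) ℝ) :
    Measurable (empError ℓ X n Q) := by
  refine Measurable.const_mul (Finset.measurable_sum _ fun i hi => ?_) _
  have hi2 := (Finset.mem_Icc.1 hi).1
  have h1 := h.measurable_process i (by omega)
  have h2 := h.measurable_process (i - 1) (by omega)
  exact hℓ.continuous.measurable.comp (h1.sub
    ((Matrix.toEuclideanCLM (n := Fin M) (𝕜 := ℝ) Q).continuous.measurable.comp h2))

variable [IsProbabilityMeasure μ]

theorem IsStationaryVAR.integrable_norm_init (h : IsStationaryVAR μ A X ξ) (hρ : ρ < 1)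
    (hA : ‖Matrix.toEuclideanCLM (n := Fin M) (𝕜 := ℝ) A‖ ≤ ρ)
    (hν : Integrable (fun z => ‖z‖) (μ.map (ξ 2))) :
    Integrable (fun x => ‖x‖) (μ.map (X 1)) ∧
      ∫ x, ‖x‖ ∂(μ.map (X 1)) ≤ (∫ z, ‖z‖ ∂(μ.map (ξ 2))) / (1 - ρ) := by
  have := Measure.isProbabilityMeasure_map (μ := μ) (h.measurable_process 1 le_rfl).aemeasurable
  have := Measure.isProbabilityMeasure_map (μ := μ) (h.measurable_noise 2 le_rfl).aemeasurable
  exact integrable_norm_of_stationary hρ hA h.init_law hν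

theorem IsStationaryVAR.integrable_predLoss_and_genError_eq (h : IsStationaryVAR μ A X ξ)
    (hν : Integrable (fun z => ‖z‖) (μ.map (ξ 2)))
    (hπi : Integrable (fun x => ‖x‖) (μ.map (X 1))) (hL : L ≤ 1) (hℓ : LipschitzWith L ℓ)
    {t : ℕ} (ht : 2 ≤ t) (Q : Matrix (Fin M) (Fin M) ℝ) :
    Integrable (predLoss ℓ X t Q) μ ∧
      genError μ ℓ X t Q = popRisk (μ.map (ξ 2)) (μ.map (X 1)) A ℓ Q := by
  have := Measure.isProbabilityMeasure_map (μ := μ) (h.measurable_process 1 le_rfl).aemeasurable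
  have := Measure.isProbabilityMeasure_map (μ := μ) (h.measurable_noise 2 le_rfl).aemeasurable
  obtain ⟨k, rfl⟩ : ∃ k, t = k + 2 := ⟨t - 2, by omega⟩
  have hint := integrable_cost_prod (A := Matrix.toEuclideanCLM (n := Fin M) (𝕜 := ℝ) A)
    (φ := fun x y => ℓ (y - Matrix.toEuclideanCLM (n := Fin M) (𝕜 := ℝ) Q x)) hν hπi
    (abs_predCost_sub_le hL hℓ le_rfl)
  have hm : Measurable fun ω => (chain A X ξ k ω, ξ (k + 2) ω) :=
    (h.measurable_chain k).prodMk (h.measurable_noise _ (by omega))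
  rw [← h.map_chain_noise k] at hint
  have hae := h.predLoss_ae_eq (ℓ := ℓ) (Q := Q) k
  refine ⟨(hint.comp_measurable hm).congr (hae.mono fun ω hω => hω.symm), ?_⟩
  rw [genError, popRisk, integral_congr_ae hae, ← h.map_chain_noise k,
    integral_map hm.aemeasurable hint.aestronglyMeasurable]
  rfl

theorem abs_popRisk_sub_le {ν π : Measure (EuclideanSpace ℝ (Fin M))} [IsProbabilityMeasure ν]
    [IsProbabilityMeasure π] (hν : Integrable (fun z => ‖z‖) ν)
    (hπi : Integrable (fun x => ‖x‖) π) (hL : L ≤ 1) (hℓ : LipschitzWith L ℓ)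
    (A Q Q' : Matrix (Fin M) (Fin M) ℝ) :
    |popRisk ν π A ℓ Q - popRisk ν π A ℓ Q'| ≤
      ‖Matrix.toEuclideanCLM (n := Fin M) (𝕜 := ℝ) (Q - Q')‖ * ∫ x, ‖x‖ ∂π := by
  have hint := fun Q : Matrix (Fin M) (Fin M) ℝ =>
    integrable_cost_prod (A := Matrix.toEuclideanCLM (n := Fin M) (𝕜 := ℝ) A)
    (φ := fun x y => ℓ (y - Matrix.toEuclideanCLM (n := Fin M) (𝕜 := ℝ) Q x)) hν hπi
    (abs_predCost_sub_le hL hℓ le_rfl)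
  rw [popRisk, popRisk, ← integral_sub (hint Q) (hint Q')]
  have e : ∫ x, ‖x‖ ∂π = ∫ p, ‖p.1‖ ∂(π.prod ν) := by
    rw [integral_fun_fst (fun x => ‖x‖)]; simp
  rw [e, ← integral_const_mul]
  refine abs_integral_le_integral_abs.trans
    (integral_mono ((hint Q).sub (hint Q')).abs ((hπi.comp_fst ν).const_mul _) fun p => ?_)
  refine (abs_sub_le_norm_of_lipschitz hL hℓ _ _).trans ?_
  rw [sub_sub_sub_cancel_left, ← norm_neg, neg_sub, ← sub_apply, ← map_sub]
  exact ContinuousLinearMap.le_opNorm _ _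

theorem exists_isLeast_popRisk {ν π : Measure (EuclideanSpace ℝ (Fin M))} [IsProbabilityMeasure ν]
    [IsProbabilityMeasure π] (hν : Integrable (fun z => ‖z‖) ν)
    (hπi : Integrable (fun x => ‖x‖) π) (hL : L ≤ 1) (hℓ : LipschitzWith L ℓ)
    (A : Matrix (Fin M) (Fin M) ℝ) (hρ0 : 0 ≤ ρ) (hρ : ρ ≤ 1) (r : ℕ) :
    ∃ Q₀ ∈ lowRankBall M ρ r, ∀ Q ∈ lowRankBall M ρ r,
      popRisk ν π A ℓ Q₀ ≤ popRisk ν π A ℓ Q := by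
  suffices hcont : Continuous (popRisk ν π A ℓ) from
    (isCompact_lowRankBall hρ).exists_isMinOn ⟨0, zero_mem_lowRankBall hρ0⟩ hcont.continuousOn
  rw [continuous_iff_continuousAt]
  intro Q
  rw [ContinuousAt, tendsto_iff_dist_tendsto_zero]
  have hlim : Filter.Tendsto (fun Q' : Matrix (Fin M) (Fin M) ℝ =>
      ‖Matrix.toEuclideanCLM (n := Fin M) (𝕜 := ℝ) (Q' - Q)‖ * ∫ x, ‖x‖ ∂π) (nhds Q)
      (nhds 0) := by
    have hc : Continuous fun Q' : Matrix (Fin M) (Fin M) ℝ =>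
        ‖Matrix.toEuclideanCLM (n := Fin M) (𝕜 := ℝ) (Q' - Q)‖ * ∫ x, ‖x‖ ∂π :=
      ((continuous_toEuclideanCLM.comp (continuous_id.sub continuous_const)).norm).mul_const _
    simpa using hc.tendsto Q
  exact squeeze_zero (fun _ => dist_nonneg)
    (fun Q' => abs_popRisk_sub_le hν hπi hL hℓ A Q' Q) hlim

/-- Deviation of the empirical risk of a fixed predictor. -/
theorem IsStationaryVAR.measure_empError_deviation_le (h : IsStationaryVAR μ A X ξ) {s B K : ℝ}
    (hs : 0 < s) (hi : Integrable (fun z => Real.exp (‖z‖ / s)) (μ.map (ξ 2)))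
    (hB : ∫ z, Real.exp (‖z‖ / s) ∂(μ.map (ξ 2)) ≤ B) (hK : 0 ≤ K) (hρK : (2 + K) * ρ ≤ K)
    (hρ : ρ < 1) (hA : ‖Matrix.toEuclideanCLM (n := Fin M) (𝕜 := ℝ) A‖ ≤ ρ)
    (hQ : ‖Matrix.toEuclideanCLM (n := Fin M) (𝕜 := ℝ) Q‖ ≤ ρ) (hL : L ≤ 1)
    (hℓ : LipschitzWith L ℓ) {n : ℕ} (hn : 2 ≤ n) {t : ℝ} (ht0 : 0 ≤ t) (ht1 : t ≤ 1) (u : ℝ) :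
    μ {ω | (2 * (1 + K) * s * u + K * (‖X 1 ω‖ + ∫ x, ‖x‖ ∂(μ.map (X 1)))) / ((n : ℝ) - 1) <
        |empError ℓ X n Q ω - popRisk (μ.map (ξ 2)) (μ.map (X 1)) A ℓ Q|} ≤
      ENNReal.ofReal
        (2 * Real.exp (((n : ℝ) - 1) * (t ^ 2 * (2 * B * Real.exp B)) - t * u)) := by
  have := Measure.isProbabilityMeasure_map (μ := μ) (h.measurable_process 1 le_rfl).aemeasurable
  have := Measure.isProbabilityMeasure_map (μ := μ) (h.measurable_noise 2 le_rfl).aemeasurable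
  have hν := integrable_norm_of_integrable_exp hs hi
  have hπi := (h.integrable_norm_init hρ hA hν).1
  have hφ := abs_predCost_sub_le (M := M) hL hℓ hQ
  have hn' : (2 : ℝ) ≤ n := by exact_mod_cast hn
  have hN0 : 0 < (n : ℝ) - 1 := by linarith
  have hNc : ((n - 1 : ℕ) : ℝ) = (n : ℝ) - 1 := by
    rw [Nat.cast_sub (by omega), Nat.cast_one]
  have hdev := measure_abs_sum_sub_valueFun_ge_le (μ := μ) (y := chain A X ξ)
    (z := fun k => ξ (k + 2)) (ν := μ.map (ξ 2))
    (A := Matrix.toEuclideanCLM (n := Fin M) (𝕜 := ℝ) A)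
    (φ := fun x y => ℓ (y - Matrix.toEuclideanCLM (n := Fin M) (𝕜 := ℝ) Q x))
    (fun k => (h.measurable_history k).comap_le) comap_history_mono
    measurable_chain_comap_history (fun k => h.measurable_noise _ (by omega)) h.indep_history
    (fun _ _ => rfl) h.map_noise hs hi hB hK hρK hA hφ ht0 ht1 (n - 1) u
  rw [hNc] at hdev
  refine (measure_mono_ae ?_).trans hdev
  have hae : ∀ᵐ ω ∂μ, ∀ k, predLoss ℓ X (k + 2) Q ω = ℓ (chain A X ξ (k + 1) ω -
      Matrix.toEuclideanCLM (n := Fin M) (𝕜 := ℝ) Q (chain A X ξ k ω)) :=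
    ae_all_iff.2 fun k => h.predLoss_ae_eq k
  filter_upwards [hae] with ω hω hlt
  -- `V` is within `K (‖X 1 ω‖ + 𝔼‖X 1‖)` of `(n - 1) R`, which is precisely the slack in the event;
  -- a larger deviation of the empirical risk forces `W` away from `V`.
  have hV := abs_valueFun_sub_mul_integral_le (π := μ.map (X 1)) hν hK hρK hA hφ h.init_law hπi
    (n - 1) (X 1 ω)
  rw [hNc] at hV
  change (2 * (1 + K) * s * u + K * (‖X 1 ω‖ + ∫ x, ‖x‖ ∂(μ.map (X 1)))) / ((n : ℝ) - 1) <
        |empError ℓ X n Q ω - popRisk (μ.map (ξ 2)) (μ.map (X 1)) A ℓ Q| at hlt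
  change 2 * (1 + K) * s * u ≤ _
  have he : empError ℓ X n Q ω = 1 / ((n : ℝ) - 1) * ∑ i ∈ Finset.range (n - 1),
      ℓ (chain A X ξ (i + 1) ω -
        Matrix.toEuclideanCLM (n := Fin M) (𝕜 := ℝ) Q (chain A X ξ i ω)) := by
    rw [empError, sum_Icc_two_eq_sum_range]
    simp only [hω]
  set W := ∑ i ∈ Finset.range (n - 1), ℓ (chain A X ξ (i + 1) ω -
        Matrix.toEuclideanCLM (n := Fin M) (𝕜 := ℝ) Q (chain A X ξ i ω))
  set V := valueFun (μ.map (ξ 2)) (Matrix.toEuclideanCLM (n := Fin M) (𝕜 := ℝ) A)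
    (fun x y => ℓ (y - Matrix.toEuclideanCLM (n := Fin M) (𝕜 := ℝ) Q x)) (n - 1) (X 1 ω)
  change |V - ((n : ℝ) - 1) * popRisk (μ.map (ξ 2)) (μ.map (X 1)) A ℓ Q| ≤ _ at hV
  change _ ≤ |W - V|
  set R := popRisk (μ.map (ξ 2)) (μ.map (X 1)) A ℓ Q
  have e2 : |empError ℓ X n Q ω - R| = |W - ((n : ℝ) - 1) * R| / ((n : ℝ) - 1) := by
    rw [he, ← abs_of_pos hN0, ← abs_div, abs_of_pos hN0]
    congr 1
    field_simp
  rw [e2, div_lt_div_iff_of_pos_right hN0] at hlt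
  have h3 := abs_sub_le W V (((n : ℝ) - 1) * R)
  linarith

theorem measure_gt_div_le {f : Ω → ℝ} (hf0 : ∀ ω, 0 ≤ f ω) (hf : Integrable f μ) {m η : ℝ}
    (hm : 0 < m) (hη : 0 < η) (hfm : ∫ ω, f ω ∂μ ≤ m) :
    μ {ω | m / η < f ω} ≤ ENNReal.ofReal η := by
  have h1 := mul_meas_ge_le_integral_of_nonneg (ae_of_all μ hf0) hf (m / η)
  have h2 : m / η * μ.real {ω | m / η ≤ f ω} ≤ m / η * η := by
    rw [div_mul_cancel₀ _ hη.ne']; exact h1.trans hfm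
  have h3 := le_of_mul_le_mul_left h2 (by positivity)
  have hsub : {ω | m / η < f ω} ⊆ {ω | m / η ≤ f ω} :=
    fun ω (hω : m / η < f ω) => (hω.le : m / η ≤ f ω)
  refine (measure_mono hsub).trans ?_
  rw [ENNReal.le_ofReal_iff_toReal_le (measure_ne_top _ _) hη.le]
  exact h3

theorem IsStationaryVAR.integrable_norm_process (h : IsStationaryVAR μ A X ξ)
    (hπi : Integrable (fun x => ‖x‖) (μ.map (X 1))) (k : ℕ) :
    Integrable (fun ω => ‖X (k + 1) ω‖) μ ∧
      ∫ ω, ‖X (k + 1) ω‖ ∂μ = ∫ x, ‖x‖ ∂(μ.map (X 1)) := by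
  have hae : ∀ᵐ ω ∂μ, ‖X (k + 1) ω‖ = ‖chain A X ξ k ω‖ :=
    (h.chain_ae_eq k).mono fun ω hω => by rw [hω]
  rw [← h.map_chain k] at hπi ⊢
  refine ⟨(hπi.comp_measurable (h.measurable_chain k)).congr (hae.mono fun _ hω => hω.symm), ?_⟩
  rw [integral_congr_ae hae, integral_map (h.measurable_chain k).aemeasurable
    continuous_norm.aestronglyMeasurable]

/-- Uniform deviation of the empirical risk over the low rank ball. -/
theorem IsStationaryVAR.exists_uniform_deviation_event (h : IsStationaryVAR μ A X ξ)
    {s B K m η : ℝ}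
    (hs : 0 < s) (hi : Integrable (fun z => Real.exp (‖z‖ / s)) (μ.map (ξ 2)))
    (hB : ∫ z, Real.exp (‖z‖ / s) ∂(μ.map (ξ 2)) ≤ B) (hK : 0 ≤ K) (hρK : (2 + K) * ρ ≤ K)
    (hρ0 : 0 ≤ ρ) (hρ : ρ < 1) (hA : ‖Matrix.toEuclideanCLM (n := Fin M) (𝕜 := ℝ) A‖ ≤ ρ)
    (hL : L ≤ 1) (hℓ : LipschitzWith L ℓ) {n r : ℕ} (hn : 2 ≤ n) (hM : 1 ≤ M) (hr : 1 ≤ r)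
    (hm0 : 0 < m) (hm : ∫ x, ‖x‖ ∂(μ.map (X 1)) ≤ m) (hη : 0 < η)
    {t : ℝ} (ht0 : 0 ≤ t) (ht1 : t ≤ 1) {u : ℝ}
    (hu : ((2 * (M * r * n) + 1) ^ (2 * (M * r)) : ℕ) * (2 * Real.exp
      (((n : ℝ) - 1) * (t ^ 2 * (2 * B * Real.exp B)) - t * u)) ≤ η) :
    ∃ E : Set Ω, MeasurableSet E ∧ ENNReal.ofReal (1 - 3 * η) ≤ μ E ∧ ∀ ω ∈ E,
      ∀ Q ∈ lowRankBall M ρ r,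
        |empError ℓ X n Q ω - popRisk (μ.map (ξ 2)) (μ.map (X 1)) A ℓ Q| ≤
          2 * (1 + K) * s * (u / ((n : ℝ) - 1)) + 2 * (1 + K) * (m / η + m) * (1 / n) := by
  have := Measure.isProbabilityMeasure_map (μ := μ) (h.measurable_process 1 le_rfl).aemeasurable
  have := Measure.isProbabilityMeasure_map (μ := μ) (h.measurable_noise 2 le_rfl).aemeasurable
  have hν := integrable_norm_of_integrable_exp hs hi
  have hπi := (h.integrable_norm_init hρ hA hν).1
  have hn' : (2 : ℝ) ≤ n := by exact_mod_cast hn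
  have hM' : (1 : ℝ) ≤ M := by exact_mod_cast hM
  have hr' : (1 : ℝ) ≤ r := by exact_mod_cast hr
  have hN0 : 0 < (n : ℝ) - 1 := by linarith
  have hNc : ((n - 1 : ℕ) : ℝ) = (n : ℝ) - 1 := by
    rw [Nat.cast_sub (by omega), Nat.cast_one]
  -- The grid step `1/(Mrn)` makes the net radius `M * (2r/q) = 2/n`.
  obtain ⟨S, hS, hcard, hnet⟩ := exists_net_lowRankBall (M := M) (r := r) hρ0 hρ.le
    (q := M * r * n) (by positivity)
  set R := popRisk (μ.map (ξ 2)) (μ.map (X 1)) A ℓ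
  set m₀ := ∫ x, ‖x‖ ∂(μ.map (X 1))
  set avg : Ω → ℝ := fun ω => 1 / ((n : ℝ) - 1) * ∑ i ∈ Finset.Icc 2 n, ‖X (i - 1) ω‖ with havg
  -- Three sources of failure, each of probability at most `η`: a deviation at some net point, a
  -- large `‖X 1‖` (the initial state term), and a large average norm (the Lipschitz constant of the
  -- empirical risk in `Q`). The last two use only Markov's inequality.
  let bad : Matrix (Fin M) (Fin M) ℝ → Set Ω := fun Q =>
    {ω | (2 * (1 + K) * s * u + K * (‖X 1 ω‖ + m₀)) / ((n : ℝ) - 1) <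
        |empError ℓ X n Q ω - R Q|}
  let bad₁ : Set Ω := {ω | m / η < ‖X 1 ω‖}
  let bad₂ : Set Ω := {ω | m / η < avg ω}
  have hX1 := h.measurable_process 1 le_rfl
  have havg_eq : avg = fun ω => 1 / ((n : ℝ) - 1) * ∑ k ∈ Finset.range (n - 1), ‖X (k + 1) ω‖ := by
    funext ω
    simp only [havg]
    rw [sum_Icc_two_eq_sum_range fun i => ‖X (i - 1) ω‖]
    rfl
  have hXk := h.integrable_norm_process hπi
  have havg_int : Integrable avg μ := by
    rw [havg_eq]
    exact (integrable_finsetSum _ fun k _ => (hXk k).1).const_mul _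
  have havg_le : ∫ ω, avg ω ∂μ ≤ m := by
    rw [havg_eq, integral_const_mul, integral_finsetSum _ fun k _ => (hXk k).1]
    simp only [(hXk _).2, Finset.sum_const, Finset.card_range, nsmul_eq_mul, hNc]
    rw [← mul_assoc, one_div_mul_cancel hN0.ne', one_mul]
    exact hm
  have havg_meas : Measurable avg := by
    rw [havg_eq]
    exact (Finset.measurable_sum _ fun k _ =>
      (h.measurable_process (k + 1) (by omega)).norm).const_mul _
  have hbad : ∀ Q, MeasurableSet (bad Q) := fun Q =>
    measurableSet_lt (((hX1.norm.add_const _).const_mul _).const_add _ |>.div_const _)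
      ((h.measurable_empError hℓ n Q).sub_const _).abs
  have hb₁ : MeasurableSet bad₁ := measurableSet_lt measurable_const hX1.norm
  have hb₂ : MeasurableSet bad₂ := measurableSet_lt measurable_const havg_meas
  set T : Set Ω := (⋃ Q ∈ S, bad Q) ∪ (bad₁ ∪ bad₂) with hT
  have hTm : MeasurableSet T :=
    (Finset.measurableSet_biUnion S fun Q _ => hbad Q).union (hb₁.union hb₂)
  have hμ₁ : μ bad₁ ≤ ENNReal.ofReal η :=
    measure_gt_div_le (fun _ => norm_nonneg _) (hXk 0).1 hm0 hη ((hXk 0).2.le.trans hm)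
  have hμ₂ : μ bad₂ ≤ ENNReal.ofReal η :=
    measure_gt_div_le (fun ω => mul_nonneg (one_div_nonneg.2 hN0.le)
      (Finset.sum_nonneg fun _ _ => norm_nonneg _)) havg_int hm0 hη havg_le
  have hμS : μ (⋃ Q ∈ S, bad Q) ≤ ENNReal.ofReal η := by
    refine (measure_biUnion_finset_le S bad).trans ?_
    calc ∑ Q ∈ S, μ (bad Q) ≤ ∑ _ ∈ S, ENNReal.ofReal (2 * Real.exp
          (((n : ℝ) - 1) * (t ^ 2 * (2 * B * Real.exp B)) - t * u)) := by
          refine Finset.sum_le_sum fun Q hQ => ?_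
          have hQρ := (hS Q hQ).2
          rw [schattenInf_eq_opNorm] at hQρ
          exact h.measure_empError_deviation_le hs hi hB hK hρK hρ hA hQρ hL hℓ hn ht0 ht1 u
      _ = ENNReal.ofReal (S.card * (2 * Real.exp
          (((n : ℝ) - 1) * (t ^ 2 * (2 * B * Real.exp B)) - t * u))) := by
          rw [Finset.sum_const, nsmul_eq_mul, ENNReal.ofReal_mul (Nat.cast_nonneg _),
            ENNReal.ofReal_natCast]
      _ ≤ ENNReal.ofReal η := by
          refine ENNReal.ofReal_le_ofReal (le_trans ?_ hu)
          gcongr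
  have hμT : μ T ≤ ENNReal.ofReal (3 * η) := by
    calc μ T ≤ μ (⋃ Q ∈ S, bad Q) + (μ bad₁ + μ bad₂) :=
          (measure_union_le _ _).trans (by gcongr; exact measure_union_le _ _)
      _ ≤ ENNReal.ofReal η + (ENNReal.ofReal η + ENNReal.ofReal η) := by gcongr
      _ = _ := by
          rw [← ENNReal.ofReal_add hη.le hη.le, ← ENNReal.ofReal_add hη.le (by positivity)]
          congr 1; ring
  -- The event involves only net points, yet the bound holds for every `Q` on it; an estimator may
  -- therefore be substituted without being measurable.
  refine ⟨Tᶜ, hTm.compl, ?_, ?_⟩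
  · rw [prob_compl_eq_one_sub hTm, ENNReal.ofReal_sub _ (by positivity), ENNReal.ofReal_one]
    gcongr
  · intro ω hω Q hQ
    simp only [hT, Set.mem_compl_iff, Set.mem_union, Set.mem_iUnion, not_or, not_exists] at hω
    obtain ⟨hωS, hω₁, hω₂⟩ := hω
    obtain ⟨Q', hQ', hQQ'⟩ := hnet Q hQ
    have hε : ‖Matrix.toEuclideanCLM (n := Fin M) (𝕜 := ℝ) (Q - Q')‖ ≤ 2 * (1 / n) := by
      refine hQQ'.trans (le_of_eq ?_)
      push_cast
      field_simp
    have h1 : |empError ℓ X n Q' ω - R Q'| ≤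
        (2 * (1 + K) * s * u + K * (‖X 1 ω‖ + m₀)) / ((n : ℝ) - 1) := not_lt.1 (hωS Q' hQ')
    have h2 : ‖X 1 ω‖ ≤ m / η := not_lt.1 hω₁
    have h3 : avg ω ≤ m / η := not_lt.1 hω₂
    have h4 : |empError ℓ X n Q ω - empError ℓ X n Q' ω| ≤ 2 * (1 / n) * (m / η) :=
      (abs_empError_sub_le hL hℓ hn Q Q' ω).trans (by gcongr)
    have h5 : |R Q' - R Q| ≤ 2 * (1 / n) * m := by
      rw [abs_sub_comm]
      refine (abs_popRisk_sub_le hν hπi hL hℓ A Q Q').trans ?_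
      have : 0 ≤ m₀ := integral_nonneg fun _ => norm_nonneg _
      gcongr
    have h6 : (2 * (1 + K) * s * u + K * (‖X 1 ω‖ + m₀)) / ((n : ℝ) - 1) ≤
        2 * (1 + K) * s * (u / ((n : ℝ) - 1)) + K * (m / η + m) * (2 * (1 / n)) := by
      have hinv : 1 / ((n : ℝ) - 1) ≤ 2 * (1 / n) := by
        rw [mul_one_div, div_le_div_iff₀ hN0 (by linarith)]; linarith
      have hX : K * (‖X 1 ω‖ + m₀) ≤ K * (m / η + m) := by gcongr
      calc _ = 2 * (1 + K) * s * (u / ((n : ℝ) - 1)) +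
            K * (‖X 1 ω‖ + m₀) * (1 / ((n : ℝ) - 1)) := by ring
        _ ≤ _ := by gcongr
    have h7 : |empError ℓ X n Q ω - R Q| ≤ |empError ℓ X n Q ω - empError ℓ X n Q' ω| +
        (|empError ℓ X n Q' ω - R Q'| + |R Q' - R Q|) :=
      (abs_sub_le _ (empError ℓ X n Q' ω) _).trans (by gcongr; exact abs_sub_le _ _ _)
    linarith

end Risk

/-! ### The oracle inequality. -/

theorem mainTheorem3 (c d ρ η : ℝ) (hc : 0 < c) (hd : 0 < d) (hρ0 : 0 < ρ) (hρ1 : ρ < 1)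
    (hη : 0 < η) :
    ∃ D₁ : ℝ, 0 < D₁ ∧
      ∀ (M n r r₀ : ℕ), 1 ≤ r → r ≤ M → 1 ≤ r₀ → r₀ ≤ M →
      (n : ℝ) ≥ 1 + 16 * delta₀ c ρ ^ 2 * M * r * Real.log (9 * r * n) / calV₀ c d ρ →
      ∀ A ∈ lowRankBall M ρ r₀,
      ∀ {Ω : Type*} [MeasurableSpace Ω] (μ : Measure Ω) [IsProbabilityMeasure μ]
        (X ξ : ℕ → Ω → EuclideanSpace ℝ (Fin M)),
      IsStationaryVAR μ A X ξ →
      (∀ t, 2 ≤ t → HasExpMoments μ (ξ t) c d) →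
      ∀ (ℓ : EuclideanSpace ℝ (Fin M) → ℝ) (L : ℝ≥0), L ≤ 1 → LipschitzWith L ℓ →
      ∀ t : ℕ, 2 ≤ t →
        (∀ Q : Matrix (Fin M) (Fin M) ℝ, Integrable (predLoss ℓ X t Q) μ) ∧
        ∃ Rmin : ℝ, IsLeast (genError μ ℓ X t '' lowRankBall M ρ r) Rmin ∧
          ∀ Ahat : Ω → Matrix (Fin M) (Fin M) ℝ, IsFixedRankEstimator ℓ X n ρ r Ahat →
          ∃ E : Set Ω, MeasurableSet E ∧ ENNReal.ofReal (1 - η) ≤ μ E ∧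
            ∀ ω ∈ E, genError μ ℓ X t (Ahat ω) ≤
              Rmin + D₁ * Real.sqrt (r * (M : ℝ) ^ 2 * (Real.log n / n)) := by
  have h1ρ : 0 < 1 - ρ := sub_pos.2 hρ1
  have hδ : 0 < delta₀ c ρ := by rw [delta₀]; positivity
  have hV : 0 < calV₀ c d ρ := by
    have : 0 < 2 - ρ := by linarith
    rw [calV₀]; positivity
  set κ := 16 * delta₀ c ρ ^ 2 / calV₀ c d ρ with hκ
  have hκ0 : 0 < κ := by positivity
  set B := 2 * d with hB
  have hB0 : 0 < B := by positivity
  -- `K (1 - ρ) = 2 ≥ 2ρ` is the fixed point condition for the Lipschitz constant of the value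
  -- functions.
  set K := 2 / (1 - ρ) with hK
  have hK0 : 0 < K := by positivity
  have hρK : (2 + K) * ρ ≤ K := by
    have : K * (1 - ρ) = 2 := by rw [hK]; field_simp
    nlinarith
  set η' := η / 3 with hη'
  have hη'0 : 0 < η' := by positivity
  obtain ⟨C, hC0, hC⟩ := exists_deviation_parameters (κ := κ) (η := η')
    (D := 2 * B * Real.exp B) hκ0 hη'0 (by positivity)
  -- The outer 2 comes from using the deviation at both the estimator and the minimizer, the last
  -- one from `1/n ≤ 2w`. The factor `√M` of `s = c√M` is left out, as it belongs to the rate.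
  refine ⟨2 * (2 * (1 + K) * c * C +
    2 * (1 + K) * (c * B / (1 - ρ) / η' + c * B / (1 - ρ)) * 2), by positivity, ?_⟩
  intro M n r r₀ hr hrM _ _ hn A hA Ω _ μ _ X ξ hVAR hexp ℓ L hL hℓ t ht
  have hM : 1 ≤ M := hr.trans hrM
  have hM' : (0 : ℝ) < M := by exact_mod_cast hM
  have := Measure.isProbabilityMeasure_map (μ := μ)
    (hVAR.measurable_process 1 le_rfl).aemeasurable
  have := Measure.isProbabilityMeasure_map (μ := μ) (hVAR.measurable_noise 2 le_rfl).aemeasurable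
  have hnκ : (n : ℝ) ≥ 1 + κ * M * r * Real.log (9 * r * n) := by
    refine le_trans (le_of_eq ?_) hn
    rw [hκ]; ring
  have hn2 := two_le_of_sample_size hκ0 hr hM hnκ
  set s := c * √M with hs
  have hs0 : 0 < s := by positivity
  obtain ⟨hi, hiB⟩ := (hexp 2 le_rfl).integrable_exp_norm hM
    (hVAR.measurable_noise 2 le_rfl) hc
  have hν := integrable_norm_of_integrable_exp hs0 hi
  have hAρ := hA.2
  rw [schattenInf_eq_opNorm] at hAρ
  obtain ⟨hπi, hπm⟩ := hVAR.integrable_norm_init hρ1 hAρ hν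
  set m := s * B / (1 - ρ) with hm
  have hm0 : 0 < m := by positivity
  have hπm' : ∫ x, ‖x‖ ∂(μ.map (X 1)) ≤ m := hπm.trans (by
    rw [hm]; gcongr; exact integral_norm_le_of_integral_exp_le hs0 hi hiB)
  have hgen := hVAR.integrable_predLoss_and_genError_eq hν hπi hL hℓ ht
  refine ⟨fun Q => (hgen Q).1, ?_⟩
  obtain ⟨Q₀, hQ₀, hmin⟩ := exists_isLeast_popRisk hν hπi hL hℓ A hρ0.le hρ1.le r
  refine ⟨genError μ ℓ X t Q₀, ⟨Set.mem_image_of_mem _ hQ₀, ?_⟩, ?_⟩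
  · rintro _ ⟨Q, hQ, rfl⟩
    rw [(hgen Q).2, (hgen Q₀).2]
    exact hmin Q hQ
  · intro Ahat hAhat
    obtain ⟨τ, u, hτ0, hτ1, hu, hub⟩ := hC M n r hr hM hnκ
    obtain ⟨E, hE, hμE, hdev⟩ := hVAR.exists_uniform_deviation_event hs0 hi hiB hK0.le hρK hρ0.le
      hρ1 hAρ hL hℓ hn2 hM hr hm0 hπm' hη'0 hτ0 hτ1 hu
    refine ⟨E, hE, by rwa [show 3 * η' = η by rw [hη']; ring] at hμE, fun ω hω => ?_⟩
    obtain ⟨hAm, hAle⟩ := hAhat ω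
    have h1 := abs_le.1 (hdev ω hω _ hAm)
    have h2 := abs_le.1 (hdev ω hω _ hQ₀)
    have h3 := hAle Q₀ hQ₀
    rw [(hgen _).2, (hgen Q₀).2]
    set w := √(M * r * (Real.log n / n)) with hw
    -- `rM² = M · (Mr)`: one factor `M` from the noise scale, `Mr` from the entropy of the net.
    have hsqrt : √(r * (M : ℝ) ^ 2 * (Real.log n / n)) = √M * w := by
      rw [hw, ← Real.sqrt_mul hM'.le]; congr 1; ring
    have h4 : 2 * (1 + K) * s * (u / ((n : ℝ) - 1)) +
        2 * (1 + K) * (m / η' + m) * (1 / n) ≤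
        (2 * (1 + K) * c * C +
          2 * (1 + K) * (c * B / (1 - ρ) / η' + c * B / (1 - ρ)) * 2) * (√M * w) := by
      have h5 := one_div_le_sqrt_log_div hr hM hn2
      calc _ ≤ 2 * (1 + K) * s * (C * w) + 2 * (1 + K) * (m / η' + m) * (2 * w) := by gcongr
        _ = _ := by rw [hm, hs]; ring
    rw [hsqrt]
    linarith
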